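/- **Conventions.** An automorphism of a point-line geometry is a permutation of its points together with a permutation of its lines which preserve incidence in both directions. For a point-line geometry $\mathcal{G}$ and a point $\omega$ of it, the synthetic line $(\mathcal{G},\omega)$ is the set of lines of $\mathcal{G}$ incident with $\omega$, and $\mathrm{Aut}(\mathcal{G},\omega)=\mathrm{Aut}(\mathcal{G})_\omega/N$, where $N$ is the kernel of the action of the stabilizer $\mathrm{Aut}(\mathcal{G})_\omega$ on the lines incident with $\omega$; we regard it as the group of permutations of these lines which is induced by $\mathrm{Aut}(\mathcal{G})_\omega$. If $\mathcal{P}$ is a projective plane, $\mu$ is a point of it and $U$ is a line not incident with $\mu$, let $\mathcal{P}_U$ be the affine plane obtained by deleting $U$ and all points incident with $U$. The lines of $\mathcal{P}_U$ incident with $\mu$ are the lines of $\mathcal{P}$ incident with $\mu$. One calls $(\mathcal{P},\mu)$ a projective type line and $(\mathcal{P}_U,\mu)$ an affine type line. The *Inheritance question* for $(\mathcal{P},\mu)$ asks whether $\mathrm{Aut}(\mathcal{P},\mu)=\bigcup_{U}\mathrm{Aut}(\mathcal{P}_U,\mu)$, where $U$ ranges over all lines not incident with $\mu$ and both sides are sets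 of permutations of the lines incident with $\mu$. The *free completion* $\overline{\mathcal{C}}$ of a point-line geometry $\mathcal{C}$ is $\bigcup_{i\ge 0}\mathcal{C}_i$, where $\mathcal{C}_0=\mathcal{C}$; for $i$ even, $\mathcal{C}_{i+1}$ arises from $\mathcal{C}_i$ by adding, for each unordered pair of distinct lines without a common point, one new point incident with exactly these two lines; for $i$ odd, $\mathcal{C}_{i+1}$ arises from $\mathcal{C}_i$ by adding, for each unordered pair of distinct points without a common line, one new line incident with exactly these two points. **Theorem.** 1. Let $\Pi$ be a Fano plane (a projective plane of order $2$) and let $(x,M)$ be an anti-flag of $\Pi$ (a point and a line which are not incident). Then $\Pi$ has an automorphism of order $3$ which fixes $x$, $M$ and no other point or line. 2. Let $\Pi$ and $(x,M)$ be as in 1, and let $\alpha$ be any automorphism of $\Pi$ of order $3$ which fixes $x$, $M$ and no other point or line. Let $\mathcal{C}=\Pi_M$ be obtained from $\Pi$ by deleting $M$ and all points incident with $M$, let $\alpha_0$ be the automorphism of $\mathcal{C}$ induced by $\alpha$, and let $\overline{\mathcal{C}}$ be the free completion of $\mathcal{C}$. Then $\overline{\mathcal{C}}$ is a projective plane with countably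 infinitely many points and lines, and $\alpha_0$ extends to a unique automorphism $\overline{\alpha}$ of $\overline{\mathcal{C}}$. The automorphism $\overline{\alpha}$ fixes $x$ and defines a nontrivial element of $\mathrm{Aut}(\overline{\mathcal{C}},x)$, that is, it acts nontrivially on the lines of $\overline{\mathcal{C}}$ incident with $x$. This element is not inherited from any affine type line: for every line $U$ of $\overline{\mathcal{C}}$ not incident with $x$, no automorphism of $\overline{\mathcal{C}}_U$ fixing $x$ induces the same permutation of the lines incident with $x$ as $\overline{\alpha}$. In particular, the Inheritance question for $(\overline{\mathcal{C}},x)$ has a negative answer. 3. Consequently, the Inheritance question has a negative answer in the infinite case: there are a countably infinite projective plane $\mathcal{P}$ and a point $\mu$ of $\mathcal{P}$ such that $\mathrm{Aut}(\mathcal{P},\mu)\neq\bigcup_{U}\mathrm{Aut}(\mathcal{P}_U,\mu)$. -/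

import Mathlib

universe u

/-- A point-line incidence structure. -/
structure PointLineGeometry where
  Point : Type u
  Line : Type u
  Inc : Point → Line → Prop

namespace PointLineGeometry

variable (G : PointLineGeometry.{u})

/-- A point belongs to a line when it is incident with it. -/
instance : Membership G.Point G.Line := ⟨fun l p => G.Inc p l⟩

/-- Projective planes, in the sense of Mathlib. -/
def IsProjectivePlane : Prop :=
  Nonempty (Configuration.ProjectivePlane G.Point G.Line)

/-- A Fano plane is a projective plane of order two: every line has exactly three points. -/
def IsFanoPlane : Prop :=
  G.IsProjectivePlane ∧ ∀ l : G.Line, Configuration.pointCount G.Point l = 3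

/-! ### Automorphisms -/

/-- The automorphism group: pairs consisting of a permutation of the points and a permutation
of the lines which together preserve incidence in both directions. -/
def Aut : Subgroup (Equiv.Perm G.Point × Equiv.Perm G.Line) where
  carrier := {α | ∀ p l, G.Inc (α.1 p) (α.2 l) ↔ G.Inc p l}
  one_mem' := fun _ _ => Iff.rfl
  mul_mem' := fun {α β} hα hβ p l => (hα (β.1 p) (β.2 l)).trans (hβ p l)
  inv_mem' := fun {α} hα p l => by
    have h := hα (α.1⁻¹ p) (α.2⁻¹ l)
    rw [← Equiv.Perm.mul_apply, ← Equiv.Perm.mul_apply, mul_inv_cancel, mul_inv_cancel] at h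
    exact h.symm

variable {G}

/-- The action of an automorphism on points. -/
def onPoints (α : G.Aut) : Equiv.Perm G.Point := α.1.1

/-- The action of an automorphism on lines. -/
def onLines (α : G.Aut) : Equiv.Perm G.Line := α.1.2

theorem inc_iff (α : G.Aut) (p : G.Point) (l : G.Line) :
    G.Inc (onPoints α p) (onLines α l) ↔ G.Inc p l :=
  α.2 p l

/-- The stabilizer in the automorphism group of a point `x`. -/
def pointStabilizer (x : G.Point) : Subgroup G.Aut where
  carrier := {α | onPoints α x = x}
  one_mem' := rfl
  mul_mem' := fun {α β} hα hβ =>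
    show onPoints α (onPoints β x) = x by
      rw [show onPoints β x = x from hβ, show onPoints α x = x from hα]
  inv_mem' := fun {α} hα =>
    show (onPoints α)⁻¹ x = x from
      Equiv.Perm.inv_eq_iff_eq.mpr (show onPoints α x = x from hα).symm

theorem inc_onLines_iff {x : G.Point} (α : pointStabilizer x) (l : G.Line) :
    G.Inc x (onLines α.1 l) ↔ G.Inc x l := by
  have h := inc_iff α.1 x l
  rwa [show onPoints α.1 x = x from α.2] at h

/-! ### Synthetic lines based at a point -/

/-- The action of the stabilizer of `x` on the lines incident with `x`. -/
def lineAction (x : G.Point) : pointStabilizer x →* Equiv.Perm {l : G.Line // G.Inc x l} where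
  toFun α := (onLines α.1).subtypePerm fun l => inc_onLines_iff α l
  map_one' := rfl
  map_mul' _ _ := rfl

/-- The automorphism group of the synthetic line `(G, x)`. The points of this line are the
lines of `G` incident with `x`, its automorphisms are the automorphisms of `G` fixing `x`, and
two of these are identified exactly when they induce the same action on the lines incident
with `x`. So this is the stabilizer of `x` modulo the kernel of its action on these lines,
realized as the permutation group which it induces on them. If `G` is a projective plane, then
`(G, x)` is a projective type line; if `G` is an affine plane, it is an affine type line. -/
def lineAut (x : G.Point) : Subgroup (Equiv.Perm {l : G.Line // G.Inc x l}) :=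
  (lineAction x).range

variable (G)

/-- The geometry obtained from `G` by deleting the line `U` and all points incident with `U`.
If `G` is a projective plane, it is the affine plane `G_U`. -/
def deleteLine (U : G.Line) : PointLineGeometry.{u} where
  Point := {p : G.Point // ¬ G.Inc p U}
  Line := {l : G.Line // l ≠ U}
  Inc p l := G.Inc p.1 l.1

variable {G}

/-- The automorphism of `G` with the line `U` deleted that is induced by an automorphism of `G`
fixing `U`. -/
def deleteLineAut (α : G.Aut) {U : G.Line} (hU : onLines α U = U) : (G.deleteLine U).Aut :=
  ⟨((onPoints α).subtypePerm (p := fun p => ¬ G.Inc p U) fun p => not_congr (by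
      have h := inc_iff α p U
      rwa [hU] at h),
    (onLines α).subtypePerm (p := fun l => l ≠ U) fun l => not_congr (by
      have h := (onLines α).apply_eq_iff_eq (x := l) (y := U)
      rwa [hU] at h)),
    fun p l => inc_iff α p.1 l.1⟩

/-- If `x` is not incident with `U`, then deleting `U` does not affect the lines incident
with `x`. -/
def affineLinesEquiv (x : G.Point) (U : G.Line) (hU : ¬ G.Inc x U) :
    {l : (G.deleteLine U).Line // (G.deleteLine U).Inc ⟨x, hU⟩ l} ≃ {l : G.Line // G.Inc x l} where
  toFun l := ⟨l.1.1, l.2⟩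
  invFun l := ⟨⟨l.1, fun h => hU (h ▸ l.2)⟩, l.2⟩
  left_inv _ := rfl
  right_inv _ := rfl

/-- The automorphism group of the affine type line `(G_U, x)`, with `x` not incident with `U`,
as a group of permutations of the lines of `G` incident with `x`. -/
def affineLineAut (x : G.Point) (U : G.Line) (hU : ¬ G.Inc x U) :
    Subgroup (Equiv.Perm {l : G.Line // G.Inc x l}) :=
  (lineAut (G := G.deleteLine U) ⟨x, hU⟩).map (affineLinesEquiv x U hU).permCongrHom.toMonoidHom

/-- The Inheritance property of the projective type line `(G, x)`: each of its automorphisms is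
an automorphism of an affine type line `(G_U, x)` for some line `U` not incident with `x`. -/
def Inheritance (x : G.Point) : Prop :=
  (lineAut x : Set (Equiv.Perm {l : G.Line // G.Inc x l})) =
    ⋃ (U : G.Line) (hU : ¬ G.Inc x U), (affineLineAut x U hU : Set _)

variable (G)

/-! ### The free completion -/

/-- Add to `G` one new point for each unordered pair of distinct lines without a common point;
it is incident with the two lines of the pair and with no other line. -/
def addPoints : PointLineGeometry.{u} where
  Point := G.Point ⊕ {s : Sym2 G.Line // ¬ s.IsDiag ∧ ¬ ∃ p, ∀ l ∈ s, G.Inc p l}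
  Line := G.Line
  Inc p l := p.elim (fun q => G.Inc q l) (fun s => l ∈ s.1)

/-- Add to `G` one new line for each unordered pair of distinct points without a common line;
it is incident with the two points of the pair and with no other point. -/
def addLines : PointLineGeometry.{u} where
  Point := G.Point
  Line := G.Line ⊕ {s : Sym2 G.Point // ¬ s.IsDiag ∧ ¬ ∃ l, ∀ p ∈ s, G.Inc p l}
  Inc p l := l.elim (fun m => G.Inc p m) (fun s => p ∈ s.1)

/-- The stages of the free construction on `G`: starting from `G`, add points and lines in turn.
Here the passage from one stage to the next consists of adding points and then adding lines. -/
def stage : ℕ → PointLineGeometry.{u}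
  | 0 => G
  | n + 1 => (stage n).addPoints.addLines

/-- The points of a stage are points of the next stage. -/
def pointSucc (n : ℕ) (p : (G.stage n).Point) : (G.stage (n + 1)).Point := Sum.inl p

/-- The lines of a stage are lines of the next stage. -/
def lineSucc (n : ℕ) (l : (G.stage n).Line) : (G.stage (n + 1)).Line := Sum.inl l

/-- A point of some stage is identified with its copy in the next stage. -/
inductive PointRel : (Σ n, (G.stage n).Point) → (Σ n, (G.stage n).Point) → Prop
  | succ (n : ℕ) (p : (G.stage n).Point) : PointRel ⟨n, p⟩ ⟨n + 1, G.pointSucc n p⟩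

/-- A line of some stage is identified with its copy in the next stage. -/
inductive LineRel : (Σ n, (G.stage n).Line) → (Σ n, (G.stage n).Line) → Prop
  | succ (n : ℕ) (l : (G.stage n).Line) : LineRel ⟨n, l⟩ ⟨n + 1, G.lineSucc n l⟩

/-- The free completion of `G`: the union (direct limit) of all stages of the free
construction. A point and a line are incident if they are so in some stage. -/
def freeCompletion : PointLineGeometry.{u} where
  Point := Quot G.PointRel
  Line := Quot G.LineRel
  Inc P L := ∃ (n : ℕ) (p : (G.stage n).Point) (l : (G.stage n).Line),
    Quot.mk _ ⟨n, p⟩ = P ∧ Quot.mk _ ⟨n, l⟩ = L ∧ (G.stage n).Inc p l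

variable {G}

/-- The points of `G` as points of its free completion. -/
def freePoint (p : G.Point) : G.freeCompletion.Point := Quot.mk _ ⟨0, p⟩

/-- The lines of `G` as lines of its free completion. -/
def freeLine (l : G.Line) : G.freeCompletion.Line := Quot.mk _ ⟨0, l⟩

/-- The automorphism `β` of the free completion of `G` extends the automorphism `α` of `G`. -/
def Extends (β : G.freeCompletion.Aut) (α : G.Aut) : Prop :=
  (∀ p, onPoints β (freePoint p) = freePoint (onPoints α p)) ∧
    ∀ l, onLines β (freeLine l) = freeLine (onLines α l)

/-- The automorphism `α` has order three, and `x` and `M` are its only fixed point and its only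
fixed line. -/
def IsOrderThreeFixingOnly (α : G.Aut) (x : G.Point) (M : G.Line) : Prop :=
  orderOf α = 3 ∧ (∀ p, onPoints α p = p ↔ p = x) ∧ ∀ l, onLines α l = l ↔ l = M

end PointLineGeometry

/-!
The free completion of the affine plane `C` of order two contains no finite confined configuration
(`hasNoConfined_freeCompletion`): a finite configuration always has a member which is incident with
at most two others, namely one added last, because a new element is incident with exactly two
earlier ones; if all members belong to `C`, take a line, because lines of `C` have two points. In particular this projective plane is
infinite, and it contains no configuration of Desargues. An automorphism fixing all lines through a
point has an axis, and if it were not trivial, Desargues' configuration could be constructed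
from it. So the identity is the only automorphism which fixes every line through a given point
(`IsProjectivePlane.onPoints_eq_of_fixes_pencil`).

Suppose that an automorphism of the affine plane belonging to a line `U` off `x` fixes `x` and
induces the same permutation of the lines through `x` as the extension of `α`. It extends to the
projective plane (`IsProjectivePlane.exists_extension`), and the extension is equal to that of
`α` by the above. So the extension of `α` fixes `U`. But it does not fix any line: it has order
three, hence a new element which is fixed would come from a pair of earlier elements which are both
fixed, and in `C` there are only one fixed point and no fixed line (`stageAut_fixed`).

The rotation of order three is read off from coordinates: a Fano plane with an anti-flag is
determined up to isomorphism (`IsFanoPlane.exists_coordinates`).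
-/

/-! ### Projective planes and their automorphisms -/

namespace PointLineGeometry

variable {G : PointLineGeometry.{u}}

/-- Two distinct points are on at most one common line; equivalently, two distinct lines have at
most one common point. -/
def IsPartialLinear (G : PointLineGeometry.{u}) : Prop :=
  ∀ ⦃p q : G.Point⦄ ⦃l m : G.Line⦄,
    G.Inc p l → G.Inc q l → G.Inc p m → G.Inc q m → p = q ∨ l = m

namespace IsPartialLinear

theorem point_eq (h : G.IsPartialLinear) {p q : G.Point} {l m : G.Line} (hlm : l ≠ m)
    (hpl : G.Inc p l) (hpm : G.Inc p m) (hql : G.Inc q l) (hqm : G.Inc q m) : p = q :=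
  (h hpl hql hpm hqm).resolve_right hlm

theorem line_eq (h : G.IsPartialLinear) {p q : G.Point} {l m : G.Line} (hpq : p ≠ q)
    (hpl : G.Inc p l) (hql : G.Inc q l) (hpm : G.Inc p m) (hqm : G.Inc q m) : l = m :=
  (h hpl hql hpm hqm).resolve_left hpq

end IsPartialLinear

namespace IsProjectivePlane

theorem isPartialLinear (h : G.IsProjectivePlane) : G.IsPartialLinear := by
  obtain ⟨h⟩ := h
  exact fun p q l m h₁ h₂ h₃ h₄ => Configuration.Nondegenerate.eq_or_eq (P := G.Point)
    (L := G.Line) h₁ h₂ h₃ h₄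

theorem exists_join (h : G.IsProjectivePlane) {p q : G.Point} (hpq : p ≠ q) :
    ∃ l, G.Inc p l ∧ G.Inc q l := by
  obtain ⟨h⟩ := h
  exact ⟨_, Configuration.HasLines.mkLine_ax (L := G.Line) hpq⟩

theorem exists_meet (h : G.IsProjectivePlane) {l m : G.Line} (hlm : l ≠ m) :
    ∃ p, G.Inc p l ∧ G.Inc p m := by
  obtain ⟨h⟩ := h
  exact ⟨_, Configuration.HasPoints.mkPoint_ax (P := G.Point) hlm⟩

theorem exists_not_inc_line (h : G.IsProjectivePlane) (l : G.Line) : ∃ p, ¬ G.Inc p l := by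
  obtain ⟨h⟩ := h
  exact Configuration.Nondegenerate.exists_point (P := G.Point) l

theorem exists_not_inc_point (h : G.IsProjectivePlane) (p : G.Point) : ∃ l, ¬ G.Inc p l := by
  obtain ⟨h⟩ := h
  exact Configuration.Nondegenerate.exists_line (L := G.Line) p

theorem exists_ne_point (h : G.IsProjectivePlane) (p : G.Point) : ∃ q, q ≠ p := by
  obtain ⟨h⟩ := h
  obtain ⟨p₁, _, p₃, _, l₂, _, h₁, -, -, -, -, -, h₃, -⟩ :=
    Configuration.ProjectivePlane.exists_config (P := G.Point) (L := G.Line)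
  by_cases hp : p₁ = p
  · exact ⟨p₃, fun e => h₁ ((hp.trans e.symm) ▸ h₃)⟩
  · exact ⟨p₁, hp⟩

theorem exists_line_through (h : G.IsProjectivePlane) (p : G.Point) : ∃ l, G.Inc p l := by
  obtain ⟨q, hq⟩ := h.exists_ne_point p
  obtain ⟨l, -, hl⟩ := h.exists_join hq
  exact ⟨l, hl⟩

theorem exists_line_through_ne (h : G.IsProjectivePlane) {p : G.Point} {l : G.Line}
    (hp : G.Inc p l) : ∃ m, G.Inc p m ∧ m ≠ l := by
  obtain ⟨q, hq⟩ := h.exists_not_inc_line l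
  have hpq : p ≠ q := fun e => hq (e ▸ hp)
  obtain ⟨m, hpm, hqm⟩ := h.exists_join hpq
  exact ⟨m, hpm, fun e => hq (e ▸ hqm)⟩

/-! ### Infinite planes -/

/-- If the plane is infinite, then so is each of its lines. If `l` were finite, then only
finitely many lines would go through a point off `l`, one of these lines `k` would be infinite,
and then infinitely many lines would go through a point off `k` and `l`. -/
theorem infinite_points_of_line (h : G.IsProjectivePlane) [Infinite G.Point]
    (h3 : ∀ l, ∃ a b c, a ≠ b ∧ a ≠ c ∧ b ≠ c ∧ G.Inc a l ∧ G.Inc b l ∧ G.Inc c l) (l : G.Line) :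
    {p | G.Inc p l}.Infinite := by
  have hpl := h.isPartialLinear
  intro hfin
  have hlines : ∀ o, ¬ G.Inc o l → {m | G.Inc o m}.Finite := by
    intro o ho
    have hne : ∀ m, G.Inc o m → m ≠ l := fun m hm e => ho (e ▸ hm)
    have : ∀ m, ∃ p, G.Inc o m → G.Inc p m ∧ G.Inc p l := by
      intro m
      by_cases hm : G.Inc o m
      · obtain ⟨p, hp⟩ := h.exists_meet (hne m hm)
        exact ⟨p, fun _ => hp⟩
      · exact ⟨o, fun hm' => absurd hm' hm⟩
    choose f hf using this
    refine Set.Finite.of_finite_image (f := f) (hfin.subset ?_) ?_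
    · rintro _ ⟨m, hm, rfl⟩
      exact (hf m hm).2
    · intro m hm m' hm' e
      refine hpl.line_eq (p := o) (q := f m) (fun e' => ho (e' ▸ (hf m hm).2)) hm (hf m hm).1 hm' ?_
      rw [e]
      exact (hf m' hm').1
  obtain ⟨o, ho⟩ := h.exists_not_inc_line l
  obtain ⟨k, hok, hk⟩ : ∃ k, G.Inc o k ∧ {p | G.Inc p k}.Infinite := by
    by_contra! hcon
    refine Set.infinite_univ (α := G.Point)
      (((hlines o ho).biUnion hcon).subset ?_)
    intro p _
    have : ∃ m, G.Inc o m ∧ G.Inc p m := by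
      by_cases e : o = p
      · obtain ⟨m, hm⟩ := h.exists_line_through o
        exact ⟨m, hm, e ▸ hm⟩
      · exact h.exists_join e
    obtain ⟨m, hom, hpm⟩ := this
    exact Set.mem_biUnion (show m ∈ {m | G.Inc o m} from hom) hpm
  have hkl : k ≠ l := fun e => ho (e ▸ hok)
  have hoff : ∀ l₁ l₂ : G.Line, l₁ ≠ l₂ → ∃ p, G.Inc p l₁ ∧ ¬ G.Inc p l₂ := by
    intro l₁ l₂ hne
    obtain ⟨a, b, _, hab, -, -, ha, hb, -⟩ := h3 l₁
    by_contra! hcon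
    exact hab (hpl.point_eq hne ha (hcon a ha) hb (hcon b hb))
  obtain ⟨a, hak, hal⟩ := hoff k l hkl
  obtain ⟨b, hbl, hbk⟩ := hoff l k hkl.symm
  obtain ⟨m, ham, hbm⟩ := h.exists_join (p := a) (q := b) (fun e => hbk (e ▸ hak))
  have hmk : m ≠ k := fun e => hbk (e ▸ hbm)
  have hml : m ≠ l := fun e => hal (e ▸ ham)
  obtain ⟨c, hcm, hck, hcl⟩ : ∃ c, G.Inc c m ∧ ¬ G.Inc c k ∧ ¬ G.Inc c l := by
    by_contra! hcon
    obtain ⟨c₁, c₂, c₃, h₁₂, h₁₃, h₂₃, h₁, h₂, h₃⟩ := h3 m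
    have key : ∀ c, G.Inc c m → c = a ∨ c = b := by
      intro c hc
      by_cases hck : G.Inc c k
      · exact Or.inl (hpl.point_eq hmk hc hck ham hak)
      · exact Or.inr (hpl.point_eq hml hc (hcon c hc hck) hbm hbl)
    rcases key _ h₁ with e₁ | e₁ <;> rcases key _ h₂ with e₂ | e₂ <;>
      rcases key _ h₃ with e₃ | e₃ <;> simp_all
  have hcp : ∀ p, G.Inc p k → c ≠ p := fun p hp e => hck (e ▸ hp)
  have : ∀ p, ∃ m, G.Inc p k → G.Inc c m ∧ G.Inc p m := by
    intro p
    by_cases hp : G.Inc p k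
    · obtain ⟨m, hm⟩ := h.exists_join (hcp p hp)
      exact ⟨m, fun _ => hm⟩
    · exact ⟨k, fun hp' => absurd hp' hp⟩
  choose f hf using this
  refine hk (Set.Finite.of_finite_image (f := f) ((hlines c hcl).subset ?_) ?_)
  · rintro _ ⟨p, hp, rfl⟩
    exact (hf p hp).1
  · intro p hp q hq e
    refine hpl.point_eq (l := f p) (m := k) (fun e' => hck (e' ▸ (hf p hp).1)) (hf p hp).2 hp ?_ hq
    rw [e]
    exact (hf q hq).2

theorem infinite_lines_through (h : G.IsProjectivePlane)
    (hinf : ∀ l, {p | G.Inc p l}.Infinite) (x : G.Point) : {l | G.Inc x l}.Infinite := by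
  obtain ⟨k, hk⟩ := h.exists_not_inc_point x
  have hcp : ∀ p, G.Inc p k → x ≠ p := fun p hp e => hk (e ▸ hp)
  have : ∀ p, ∃ m, G.Inc p k → G.Inc x m ∧ G.Inc p m := by
    intro p
    by_cases hp : G.Inc p k
    · obtain ⟨m, hm⟩ := h.exists_join (hcp p hp)
      exact ⟨m, fun _ => hm⟩
    · exact ⟨k, fun hp' => absurd hp' hp⟩
  choose f hf using this
  intro hfin
  refine hinf k (Set.Finite.of_finite_image (f := f) (hfin.subset ?_) ?_)
  · rintro _ ⟨p, hp, rfl⟩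
    exact (hf p hp).1
  · intro p hp q hq e
    refine h.isPartialLinear.point_eq (l := f p) (m := k) (fun e' => hk (e' ▸ (hf p hp).1))
      (hf p hp).2 hp ?_ hq
    rw [e]
    exact (hf q hq).2

/-! ### Central collineations -/

/-- An automorphism fixing all lines through a point `x` has an axis, that is, a line all points
of which are fixed. Every line `m` off `x` contains a fixed point, namely a common point of `m`
and its image. If a line off `x` is fixed, it is an axis; otherwise all fixed points are on one
line through `x`, and this is an axis. -/
theorem exists_axis (h : G.IsProjectivePlane) (γ : G.Aut) {x : G.Point} (hx : onPoints γ x = x)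
    (hγ : ∀ l, G.Inc x l → onLines γ l = l) : ∃ A, ∀ p, G.Inc p A → onPoints γ p = p := by
  have hpl := h.isPartialLinear
  have hfix : ∀ p m, ¬ G.Inc x m → G.Inc p m → G.Inc (onPoints γ p) m → onPoints γ p = p := by
    intro p m hxm hp hp'
    obtain ⟨k, hxk, hpk⟩ := h.exists_join (p := x) (q := p) (fun e => hxm (e ▸ hp))
    refine hpl.point_eq (l := m) (m := k) (fun e => hxm (e ▸ hxk)) hp' ?_ hp hpk
    rw [← hγ k hxk]
    exact (inc_iff γ p k).2 hpk
  have hmem : ∀ m, ¬ G.Inc x m → ∃ c, G.Inc c m ∧ onPoints γ c = c := by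
    intro m hxm
    by_cases hm : onLines γ m = m
    · obtain ⟨k, hxk⟩ := h.exists_line_through x
      obtain ⟨c, hcm, -⟩ := h.exists_meet (l := m) (m := k) (fun e => hxm (e ▸ hxk))
      refine ⟨c, hcm, hfix c m hxm hcm ?_⟩
      have := (inc_iff γ c m).2 hcm
      rwa [hm] at this
    · obtain ⟨c, hc', hcm⟩ := h.exists_meet hm
      refine ⟨c, hcm, hfix c _ ?_ hc' ((inc_iff γ c m).2 hcm)⟩
      intro hx'
      rw [← hx] at hx'
      exact hxm ((inc_iff γ x m).1 hx')
  by_cases hU : ∃ U, ¬ G.Inc x U ∧ onLines γ U = U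
  · obtain ⟨U, hxU, hU⟩ := hU
    refine ⟨U, fun p hp => hfix p U hxU hp ?_⟩
    have := (inc_iff γ p U).2 hp
    rwa [hU] at this
  · push Not at hU
    obtain ⟨m, hxm⟩ := h.exists_not_inc_point x
    obtain ⟨c, hcm, hc⟩ := hmem m hxm
    have hxc : x ≠ c := fun e => hxm (e ▸ hcm)
    obtain ⟨A, hxA, hcA⟩ := h.exists_join hxc
    refine ⟨A, fun p hpA => ?_⟩
    by_cases hpx : p = x
    · rw [hpx, hx]
    obtain ⟨n, hpn, hnA⟩ := h.exists_line_through_ne hpA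
    have hxn : ¬ G.Inc x n := fun hxn => hnA (hpl.line_eq hpx hpn hxn hpA hxA)
    obtain ⟨d, hdn, hd⟩ := hmem n hxn
    by_cases hdA : G.Inc d A
    · rwa [hpl.point_eq hnA hpn hpA hdn hdA]
    · exfalso
      have hcd : c ≠ d := fun e => hdA (e ▸ hcA)
      obtain ⟨k, hck, hdk⟩ := h.exists_join hcd
      have hxk : ¬ G.Inc x k := fun hxk => hdA (hpl.line_eq hxc hxk hck hxA hcA ▸ hdk)
      refine hU k hxk (hpl.line_eq hcd ?_ ?_ hck hdk)
      · have := (inc_iff γ c k).2 hck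
        rwa [hc] at this
      · have := (inc_iff γ d k).2 hdk
        rwa [hd] at this

end IsProjectivePlane

/-- There is no finite nonempty confined configuration: a configuration of points and lines
of `G` is confined if each of its points is incident with at least three of its lines and each
of its lines is incident with at least three of its points. -/
def HasNoConfined (G : PointLineGeometry.{u}) : Prop :=
  ∀ (S : Finset G.Point) (T : Finset G.Line), S.Nonempty →
    (∀ p ∈ S, ∃ a ∈ T, ∃ b ∈ T, ∃ c ∈ T, a ≠ b ∧ a ≠ c ∧ b ≠ c ∧
      G.Inc p a ∧ G.Inc p b ∧ G.Inc p c) →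
    (∀ l ∈ T, ∃ a ∈ S, ∃ b ∈ S, ∃ c ∈ S, a ≠ b ∧ a ≠ c ∧ b ≠ c ∧
      G.Inc a l ∧ G.Inc b l ∧ G.Inc c l) → False

namespace IsProjectivePlane

theorem exists_point_avoiding (h : G.IsProjectivePlane)
    (hpts : ∀ l, {p | G.Inc p l}.Infinite) (x : G.Point) {l m n : G.Line} (hm : l ≠ m)
    (hn : l ≠ n) : ∃ p, G.Inc p l ∧ p ≠ x ∧ ¬ G.Inc p m ∧ ¬ G.Inc p n := by
  classical
  have hpl := h.isPartialLinear
  obtain ⟨a, hal, ham⟩ := h.exists_meet hm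
  obtain ⟨b, hbl, hbn⟩ := h.exists_meet hn
  obtain ⟨p, hp, hpn⟩ := (hpts l).exists_notMem_finset {x, a, b}
  simp only [Finset.mem_insert, Finset.mem_singleton, not_or] at hpn
  exact ⟨p, hp, hpn.1, fun hpm => hpn.2.1 (hpl.point_eq hm hp hpm hal ham),
    fun hpn' => hpn.2.2 (hpl.point_eq hn hp hpn' hbl hbn)⟩

/-- In an infinite projective plane without finite confined configurations, an automorphism
fixing all lines through a point is trivial: by Desargues' configuration, with the given point
as centre and the axis of the automorphism as axis. -/
theorem onPoints_eq_of_fixes_pencil (h : G.IsProjectivePlane) (hconf : G.HasNoConfined)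
    (hpts : ∀ l, {p | G.Inc p l}.Infinite) (γ : G.Aut) {x : G.Point} (hx : onPoints γ x = x)
    (hγ : ∀ l, G.Inc x l → onLines γ l = l) (p : G.Point) : onPoints γ p = p := by
  classical
  by_contra hp
  have hpl := h.isPartialLinear
  have hlines := h.infinite_lines_through hpts
  obtain ⟨A, hA⟩ := h.exists_axis γ hx hγ
  have hpx : p ≠ x := fun e => hp (by rw [e, hx])
  have hpA : ¬ G.Inc p A := fun hpA => hp (hA p hpA)
  obtain ⟨l₁, hpl₁, hxl₁⟩ := h.exists_join hpx
  obtain ⟨l₂, hxl₂, hl₂⟩ := (hlines x).exists_notMem_finset {l₁, A}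
  simp only [Finset.mem_insert, Finset.mem_singleton, not_or] at hl₂
  obtain ⟨l₃, hxl₃, hl₃⟩ := (hlines x).exists_notMem_finset {l₁, l₂, A}
  simp only [Finset.mem_insert, Finset.mem_singleton, not_or] at hl₃
  have hxl₂ : G.Inc x l₂ := hxl₂
  have hxl₃ : G.Inc x l₃ := hxl₃
  obtain ⟨q, hql₂, hqx, hqA, -⟩ := h.exists_point_avoiding hpts x hl₂.2 hl₂.2
  have hql₁ : ¬ G.Inc q l₁ := fun hq => hqx (hpl.point_eq hl₂.1 hql₂ hq hxl₂ hxl₁)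
  have hpq : p ≠ q := fun e => hql₁ (e ▸ hpl₁)
  obtain ⟨d₃, hpd₃, hqd₃⟩ := h.exists_join hpq
  have hxd₃ : ¬ G.Inc x d₃ := fun hx' => hql₁ (hpl.line_eq hpx hpd₃ hx' hpl₁ hxl₁ ▸ hqd₃)
  obtain ⟨r, hrl₃, hrx, hrA, hrd₃⟩ := h.exists_point_avoiding hpts x hl₃.2.2
    (fun e => hxd₃ (e ▸ hxl₃) : l₃ ≠ d₃)
  have hrl₁ : ¬ G.Inc r l₁ := fun hr => hrx (hpl.point_eq hl₃.1 hrl₃ hr hxl₃ hxl₁)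
  have hrl₂ : ¬ G.Inc r l₂ := fun hr => hrx (hpl.point_eq hl₃.2.1 hrl₃ hr hxl₃ hxl₂)
  have hpr : p ≠ r := fun e => hrl₁ (e ▸ hpl₁)
  have hqr : q ≠ r := fun e => hrl₂ (e ▸ hql₂)
  obtain ⟨d₂, hpd₂, hrd₂⟩ := h.exists_join hpr
  obtain ⟨d₁, hqd₁, hrd₁⟩ := h.exists_join hqr
  have hxd₂ : ¬ G.Inc x d₂ := fun hx' => hrl₁ (hpl.line_eq hpx hpd₂ hx' hpl₁ hxl₁ ▸ hrd₂)
  have hxd₁ : ¬ G.Inc x d₁ := fun hx' => hrl₂ (hpl.line_eq hqx hqd₁ hx' hql₂ hxl₂ ▸ hrd₁)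
  have hd₂₃ : d₂ ≠ d₃ := fun e => hrd₃ (e ▸ hrd₂)
  have hd₁₃ : d₁ ≠ d₃ := fun e => hrd₃ (e ▸ hrd₁)
  have hd₁₂ : d₁ ≠ d₂ := fun e => hd₁₃ (hpl.line_eq hpq (e ▸ hpd₂) hqd₁ hpd₃ hqd₃)
  -- a point on a fixed line off the centre is fixed
  have hfix : ∀ s d, ¬ G.Inc x d → onLines γ d = d → G.Inc s d → onPoints γ s = s := by
    intro s d hxd hd hsd
    obtain ⟨k, hxk, hsk⟩ := h.exists_join (p := x) (q := s) (fun e => hxd (e ▸ hsd))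
    refine hpl.point_eq (l := d) (m := k) (fun e => hxd (e ▸ hxk)) ?_ ?_ hsd hsk
    · have := (inc_iff γ s d).2 hsd
      rwa [hd] at this
    · have := (inc_iff γ s k).2 hsk
      rwa [hγ k hxk] at this
  -- a fixed point off the axis and off the line through `x` and `p` would force `p` to be fixed
  have hnfix : ∀ s d, ¬ G.Inc s A → ¬ G.Inc x d → G.Inc s d → G.Inc p d → onPoints γ s ≠ s := by
    intro s d hsA hxd hsd hpd hs
    obtain ⟨t, htd, htA⟩ := h.exists_meet (l := d) (m := A) (fun e => hsA (e ▸ hsd))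
    refine hp (hfix p d hxd (hpl.line_eq (p := s) (q := t) (fun e => hsA (e ▸ htA)) ?_ ?_ hsd htd)
      hpd)
    · have := (inc_iff γ s d).2 hsd
      rwa [hs] at this
    · have := (inc_iff γ t d).2 htd
      rwa [hA t htA] at this
  have hq : onPoints γ q ≠ q := hnfix q d₃ hqA hxd₃ hqd₃ hpd₃
  have hr : onPoints γ r ≠ r := hnfix r d₂ hrA hxd₂ hrd₂ hpd₂
  have hγd₁ : onLines γ d₁ ≠ d₁ := fun e => hq (hfix q d₁ hxd₁ e hqd₁)
  have hγd₂ : onLines γ d₂ ≠ d₂ := fun e => hp (hfix p d₂ hxd₂ e hpd₂)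
  have hγd₃ : onLines γ d₃ ≠ d₃ := fun e => hp (hfix p d₃ hxd₃ e hpd₃)
  have hdA : ∀ s d, ¬ G.Inc s A → G.Inc s d → d ≠ A := fun s d hs hsd e => hs (e ▸ hsd)
  have hA' : ∀ s, onPoints γ s ≠ s → ¬ G.Inc (onPoints γ s) A := fun s hs hsA =>
    hs ((onPoints γ).injective (hA _ hsA))
  have hl : ∀ s l, G.Inc x l → G.Inc s l → G.Inc (onPoints γ s) l := by
    intro s l hxl hsl
    have := (inc_iff γ s l).2 hsl
    rwa [hγ l hxl] at this
  have hγx : ∀ s, s ≠ x → x ≠ onPoints γ s := fun s hs e =>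
    hs ((onPoints γ).injective (e.symm.trans hx.symm))
  have hxd : ∀ d, ¬ G.Inc x d → ¬ G.Inc x (onLines γ d) := by
    intro d hd hd'
    rw [← hx] at hd'
    exact hd ((inc_iff γ x d).1 hd')
  have him : ∀ s d, G.Inc s d → G.Inc (onPoints γ s) (onLines γ d) := fun s d =>
    (inc_iff γ s d).2
  have him' : ∀ s d, G.Inc s A → G.Inc s d → G.Inc s (onLines γ d) := by
    intro s d hs hsd
    have := him s d hsd
    rwa [hA s hs] at this
  have hne : ∀ s t, G.Inc s A → ¬ G.Inc t A → t ≠ s := fun s t hs ht e => ht (e ▸ hs)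
  have hlne : ∀ l d, G.Inc x l → ¬ G.Inc x d → l ≠ d := fun l d hl hd e => hd (e ▸ hl)
  obtain ⟨a₁, had₁, haA₁⟩ := h.exists_meet (hdA q d₁ hqA hqd₁)
  obtain ⟨a₂, had₂, haA₂⟩ := h.exists_meet (hdA p d₂ hpA hpd₂)
  obtain ⟨a₃, had₃, haA₃⟩ := h.exists_meet (hdA p d₃ hpA hpd₃)
  have ha₂₃ : a₂ ≠ a₃ := fun e =>
    hne a₂ p haA₂ hpA (hpl.point_eq hd₂₃ hpd₂ hpd₃ had₂ (e ▸ had₃))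
  have ha₁₃ : a₁ ≠ a₃ := fun e =>
    hne a₁ q haA₁ hqA (hpl.point_eq hd₁₃ hqd₁ hqd₃ had₁ (e ▸ had₃))
  have ha₁₂ : a₁ ≠ a₂ := fun e =>
    hne a₁ r haA₁ hrA (hpl.point_eq hd₁₂ hrd₁ hrd₂ had₁ (e ▸ had₂))
  have hPi := (onPoints γ).injective
  have hLi := (onLines γ).injective
  refine hconf {x, p, q, r, onPoints γ p, onPoints γ q, onPoints γ r, a₁, a₂, a₃}
    {l₁, l₂, l₃, d₁, d₂, d₃, onLines γ d₁, onLines γ d₂, onLines γ d₃, A} ⟨x, by simp⟩ ?_ ?_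
  · simp only [Finset.mem_insert, Finset.mem_singleton, forall_eq_or_imp, forall_eq]
    refine ⟨?_, ?_, ?_, ?_, ?_, ?_, ?_, ?_, ?_, ?_⟩
    · exact ⟨l₁, by simp, l₂, by simp, l₃, by simp, Ne.symm hl₂.1, Ne.symm hl₃.1,
        Ne.symm hl₃.2.1, hxl₁, hxl₂, hxl₃⟩
    · exact ⟨l₁, by simp, d₂, by simp, d₃, by simp, hlne _ _ hxl₁ hxd₂, hlne _ _ hxl₁ hxd₃,
        hd₂₃, hpl₁, hpd₂, hpd₃⟩
    · exact ⟨l₂, by simp, d₁, by simp, d₃, by simp, hlne _ _ hxl₂ hxd₁, hlne _ _ hxl₂ hxd₃,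
        hd₁₃, hql₂, hqd₁, hqd₃⟩
    · exact ⟨l₃, by simp, d₁, by simp, d₂, by simp, hlne _ _ hxl₃ hxd₁, hlne _ _ hxl₃ hxd₂,
        hd₁₂, hrl₃, hrd₁, hrd₂⟩
    · exact ⟨l₁, by simp, onLines γ d₂, by simp, onLines γ d₃, by simp,
        hlne _ _ hxl₁ (hxd _ hxd₂), hlne _ _ hxl₁ (hxd _ hxd₃), hLi.ne hd₂₃, hl _ _ hxl₁ hpl₁,
        him _ _ hpd₂, him _ _ hpd₃⟩
    · exact ⟨l₂, by simp, onLines γ d₁, by simp, onLines γ d₃, by simp,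
        hlne _ _ hxl₂ (hxd _ hxd₁), hlne _ _ hxl₂ (hxd _ hxd₃), hLi.ne hd₁₃, hl _ _ hxl₂ hql₂,
        him _ _ hqd₁, him _ _ hqd₃⟩
    · exact ⟨l₃, by simp, onLines γ d₁, by simp, onLines γ d₂, by simp,
        hlne _ _ hxl₃ (hxd _ hxd₁), hlne _ _ hxl₃ (hxd _ hxd₂), hLi.ne hd₁₂, hl _ _ hxl₃ hrl₃,
        him _ _ hrd₁, him _ _ hrd₂⟩
    · exact ⟨d₁, by simp, onLines γ d₁, by simp, A, by simp, hγd₁.symm, hdA q _ hqA hqd₁,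
        hdA _ _ (hA' q hq) (him _ _ hqd₁), had₁, him' _ _ haA₁ had₁, haA₁⟩
    · exact ⟨d₂, by simp, onLines γ d₂, by simp, A, by simp, hγd₂.symm, hdA p _ hpA hpd₂,
        hdA _ _ (hA' p hp) (him _ _ hpd₂), had₂, him' _ _ haA₂ had₂, haA₂⟩
    · exact ⟨d₃, by simp, onLines γ d₃, by simp, A, by simp, hγd₃.symm, hdA p _ hpA hpd₃,
        hdA _ _ (hA' p hp) (him _ _ hpd₃), had₃, him' _ _ haA₃ had₃, haA₃⟩
  · simp only [Finset.mem_insert, Finset.mem_singleton, forall_eq_or_imp, forall_eq]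
    refine ⟨?_, ?_, ?_, ?_, ?_, ?_, ?_, ?_, ?_, ?_⟩
    · exact ⟨x, by simp, p, by simp, onPoints γ p, by simp, hpx.symm, hγx p hpx, Ne.symm hp,
        hxl₁, hpl₁, hl _ _ hxl₁ hpl₁⟩
    · exact ⟨x, by simp, q, by simp, onPoints γ q, by simp, hqx.symm, hγx q hqx, Ne.symm hq,
        hxl₂, hql₂, hl _ _ hxl₂ hql₂⟩
    · exact ⟨x, by simp, r, by simp, onPoints γ r, by simp, hrx.symm, hγx r hrx, Ne.symm hr,
        hxl₃, hrl₃, hl _ _ hxl₃ hrl₃⟩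
    · exact ⟨q, by simp, r, by simp, a₁, by simp, hqr, hne _ _ haA₁ hqA, hne _ _ haA₁ hrA,
        hqd₁, hrd₁, had₁⟩
    · exact ⟨p, by simp, r, by simp, a₂, by simp, hpr, hne _ _ haA₂ hpA, hne _ _ haA₂ hrA,
        hpd₂, hrd₂, had₂⟩
    · exact ⟨p, by simp, q, by simp, a₃, by simp, hpq, hne _ _ haA₃ hpA, hne _ _ haA₃ hqA,
        hpd₃, hqd₃, had₃⟩
    · exact ⟨onPoints γ q, by simp, onPoints γ r, by simp, a₁, by simp, hPi.ne hqr,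
        hne _ _ haA₁ (hA' q hq), hne _ _ haA₁ (hA' r hr), him _ _ hqd₁, him _ _ hrd₁,
        him' _ _ haA₁ had₁⟩
    · exact ⟨onPoints γ p, by simp, onPoints γ r, by simp, a₂, by simp, hPi.ne hpr,
        hne _ _ haA₂ (hA' p hp), hne _ _ haA₂ (hA' r hr), him _ _ hpd₂, him _ _ hrd₂,
        him' _ _ haA₂ had₂⟩
    · exact ⟨onPoints γ p, by simp, onPoints γ q, by simp, a₃, by simp, hPi.ne hpq,
        hne _ _ haA₃ (hA' p hp), hne _ _ haA₃ (hA' q hq), him _ _ hpd₃, him _ _ hqd₃,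
        him' _ _ haA₃ had₃⟩
    · exact ⟨a₁, by simp, a₂, by simp, a₃, by simp, ha₁₂, ha₁₃, ha₂₃, haA₁, haA₂, haA₃⟩

end IsProjectivePlane

end PointLineGeometry

/-! ### From affine planes to projective planes -/

namespace PointLineGeometry

variable {G : PointLineGeometry.{u}}

/-- An automorphism of the affine plane `G_U` maps parallel classes to parallel classes, hence
acts on the points of `U`. The image of `p` on `U` is found on the image of the line through `p`
and an affine point `x`. -/
theorem IsProjectivePlane.exists_points_extension (h : G.IsProjectivePlane) {x : G.Point}
    {U : G.Line} (hU : ¬ G.Inc x U) (δ : (G.deleteLine U).Aut) :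
    ∃ f : G.Point → G.Point, (∀ p (hp : ¬ G.Inc p U), f p = (onPoints δ ⟨p, hp⟩).1) ∧
      (∀ p, G.Inc p U → G.Inc (f p) U) ∧
      ∀ p l (hl : l ≠ U), G.Inc p l → G.Inc (f p) (onLines δ ⟨l, hl⟩).1 := by
  have hpl := h.isPartialLinear
  have hex : ∀ p, ∃ q, (∀ hp : ¬ G.Inc p U, q = (onPoints δ ⟨p, hp⟩).1) ∧
      (G.Inc p U → G.Inc q U) ∧
      ∀ l (hl : l ≠ U), G.Inc p l → G.Inc q (onLines δ ⟨l, hl⟩).1 := by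
    intro p
    by_cases hp : G.Inc p U
    · obtain ⟨k, hxk, hpk⟩ := h.exists_join (p := x) (q := p) (fun e => hU (e ▸ hp))
      have hkU : k ≠ U := fun e => hU (e ▸ hxk)
      obtain ⟨q, hqk, hqU⟩ := h.exists_meet (onLines δ ⟨k, hkU⟩).2
      refine ⟨q, fun hp' => absurd hp hp', fun _ => hqU, fun l hl hpl' => ?_⟩
      by_cases hlk : l = k
      · subst hlk
        exact hqk
      have hne : (onLines δ ⟨l, hl⟩).1 ≠ (onLines δ ⟨k, hkU⟩).1 := fun e =>
        hlk (congrArg Subtype.val ((onLines δ).injective (Subtype.ext e)))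
      obtain ⟨s, hsl, hsk⟩ := h.exists_meet hne
      by_cases hsU : G.Inc s U
      · rwa [hpl.point_eq (onLines δ ⟨k, hkU⟩).2 hqk hqU hsk hsU]
      · -- an affine common point of the images would be the image of an affine common point
        exfalso
        obtain ⟨t, ht⟩ := (onPoints δ).surjective ⟨s, hsU⟩
        have htl : G.Inc t.1 l := by
          refine (inc_iff δ t ⟨l, hl⟩).1 ?_
          rw [ht]
          exact hsl
        have htk : G.Inc t.1 k := by
          refine (inc_iff δ t ⟨k, hkU⟩).1 ?_
          rw [ht]
          exact hsk
        exact t.2 (hpl.point_eq hlk htl htk hpl' hpk ▸ hp)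
    · exact ⟨_, fun _ => rfl, fun hp' => absurd hp' hp, fun l hl hpl' =>
        (inc_iff δ ⟨p, hp⟩ ⟨l, hl⟩).2 hpl'⟩
  choose f hf using hex
  exact ⟨f, fun p hp => (hf p).1 hp, fun p => (hf p).2.1, fun p => (hf p).2.2⟩

/-- An automorphism of the affine plane `G_U` which fixes a point `x` extends to the projective
plane `G`. -/
theorem IsProjectivePlane.exists_extension (h : G.IsProjectivePlane) {x : G.Point}
    {U : G.Line} (hU : ¬ G.Inc x U) (δ : (G.deleteLine U).Aut)
    (hδ : onPoints δ ⟨x, hU⟩ = ⟨x, hU⟩) :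
    ∃ β : G.Aut, onPoints β x = x ∧ onLines β U = U ∧
      ∀ l (hl : l ≠ U), onLines β l = (onLines δ ⟨l, hl⟩).1 := by
  classical
  have hpl := h.isPartialLinear
  have hPinv : ∀ (ε : (G.deleteLine U).Aut) p (hp : ¬ G.Inc p U),
      (onPoints ε⁻¹ (onPoints ε ⟨p, hp⟩)).1 = p :=
    fun ε p hp => congrArg Subtype.val ((onPoints ε).symm_apply_apply ⟨p, hp⟩)
  have hLinv : ∀ (ε : (G.deleteLine U).Aut) l (hl : l ≠ U),
      (onLines ε⁻¹ (onLines ε ⟨l, hl⟩)).1 = l :=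
    fun ε l hl => congrArg Subtype.val ((onLines ε).symm_apply_apply ⟨l, hl⟩)
  have key : ∀ (ε : (G.deleteLine U).Aut) (f g : G.Point → G.Point),
      (∀ p (hp : ¬ G.Inc p U), f p = (onPoints ε ⟨p, hp⟩).1) →
      (∀ p, G.Inc p U → G.Inc (f p) U) →
      (∀ p l (hl : l ≠ U), G.Inc p l → G.Inc (f p) (onLines ε ⟨l, hl⟩).1) →
      (∀ p (hp : ¬ G.Inc p U), g p = (onPoints ε⁻¹ ⟨p, hp⟩).1) →
      (∀ p, G.Inc p U → G.Inc (g p) U) →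
      (∀ p l (hl : l ≠ U), G.Inc p l → G.Inc (g p) (onLines ε⁻¹ ⟨l, hl⟩).1) →
      ∀ p, g (f p) = p := by
    intro ε f g hf hfU hfl hg hgU hgl p
    by_cases hp : G.Inc p U
    · obtain ⟨k, hxk, hpk⟩ := h.exists_join (p := x) (q := p) (fun e => hU (e ▸ hp))
      have hkU : k ≠ U := fun e => hU (e ▸ hxk)
      have h1 : G.Inc (g (f p)) (onLines ε⁻¹ (onLines ε ⟨k, hkU⟩)).1 :=
        hgl _ _ (onLines ε ⟨k, hkU⟩).2 (hfl p k hkU hpk)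
      rw [hLinv] at h1
      exact hpl.point_eq hkU h1 (hgU _ (hfU p hp)) hpk hp
    · have h1 : g (onPoints ε ⟨p, hp⟩).1 = (onPoints ε⁻¹ (onPoints ε ⟨p, hp⟩)).1 :=
        hg _ (onPoints ε ⟨p, hp⟩).2
      rw [hPinv] at h1
      rw [hf p hp, h1]
  obtain ⟨f, hf, hfU, hfl⟩ := h.exists_points_extension hU δ
  obtain ⟨g, hg, hgU, hgl⟩ := h.exists_points_extension hU δ⁻¹
  have hgf := key δ f g hf hfU hfl hg hgU hgl
  have hfg := key δ⁻¹ g f hg hgU hgl (by rwa [inv_inv]) hfU (by rwa [inv_inv])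
  let fL : Equiv.Perm G.Line := Equiv.Perm.ofSubtype (p := fun l => l ≠ U) (onLines δ)
  have hfLU : fL U = U := Equiv.Perm.ofSubtype_apply_of_not_mem _ (by simp)
  have hfLl : ∀ l (hl : l ≠ U), fL l = (onLines δ ⟨l, hl⟩).1 := fun l hl =>
    Equiv.Perm.ofSubtype_apply_of_mem (p := fun l => l ≠ U) (onLines δ) hl
  refine ⟨⟨(⟨f, g, hgf, hfg⟩, fL), ?_⟩, ?_, hfLU, hfLl⟩
  · intro p l
    change G.Inc (f p) (fL l) ↔ G.Inc p l
    by_cases hl : l = U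
    · subst hl
      rw [hfLU]
      refine ⟨fun hp => ?_, hfU p⟩
      rw [← hgf p]
      exact hgU _ hp
    · rw [hfLl l hl]
      refine ⟨fun hp => ?_, hfl p l hl⟩
      have h1 : G.Inc (g (f p)) (onLines δ⁻¹ (onLines δ ⟨l, hl⟩)).1 :=
        hgl _ _ (onLines δ ⟨l, hl⟩).2 hp
      rwa [hLinv, hgf] at h1
  · change f x = x
    rw [hf x hU, hδ]

/-- The permutations of the lines through `x` induced by an affine type line `(G_U, x)` are
induced by automorphisms of `G` fixing `x` and `U`. -/
theorem IsProjectivePlane.exists_aut_of_mem_affineLineAut (h : G.IsProjectivePlane)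
    {x : G.Point} {U : G.Line} (hU : ¬ G.Inc x U) {σ : Equiv.Perm {l : G.Line // G.Inc x l}}
    (hσ : σ ∈ affineLineAut x U hU) :
    ∃ β : G.Aut, onPoints β x = x ∧ onLines β U = U ∧
      ∀ l (hl : G.Inc x l), onLines β l = (σ ⟨l, hl⟩).1 := by
  obtain ⟨_, ⟨δ, rfl⟩, rfl⟩ := hσ
  obtain ⟨β, hβx, hβU, hβ⟩ := h.exists_extension hU δ.1 δ.2
  exact ⟨β, hβx, hβU, fun l hl => hβ l fun e => hU (e ▸ hl)⟩

/-- Let `α` be an automorphism of an infinite projective plane without finite confined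
configurations. If `α` fixes `x` but no line off `x`, its action on the lines through `x` is not
inherited from any affine type line: an automorphism fixing `x` and `U` which induces the same
action would be `α`, but `α` does not fix `U`. -/
theorem IsProjectivePlane.lineAction_notMem_affineLineAut (h : G.IsProjectivePlane)
    (hconf : G.HasNoConfined) (hpts : ∀ l, {p | G.Inc p l}.Infinite) {x : G.Point} {α : G.Aut}
    (hα : α ∈ pointStabilizer x) (hfix : ∀ l, onLines α l ≠ l) (U : G.Line)
    (hU : ¬ G.Inc x U) : lineAction x ⟨α, hα⟩ ∉ affineLineAut x U hU := by
  intro hmem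
  obtain ⟨β, hβx, hβU, hβ⟩ := h.exists_aut_of_mem_affineLineAut hU hmem
  have hβα : ∀ p, onPoints (α⁻¹ * β) p = p := by
    refine h.onPoints_eq_of_fixes_pencil hconf hpts (α⁻¹ * β) (x := x) ?_ ?_
    · change (onPoints α)⁻¹ (onPoints β x) = x
      rw [hβx, Equiv.Perm.inv_eq_iff_eq]
      exact (show onPoints α x = x from hα).symm
    · intro l hl
      change (onLines α)⁻¹ (onLines β l) = l
      rw [hβ l hl, Equiv.Perm.inv_eq_iff_eq]
      rfl
  -- an automorphism fixing all points fixes all lines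
  refine hfix U ?_
  have hU' : onLines (α⁻¹ * β) U = U := by
    obtain ⟨p, hp, q, hq, hpq⟩ := (hpts U).nontrivial
    refine h.isPartialLinear.line_eq hpq ?_ ?_ hp hq
    · have := (inc_iff (α⁻¹ * β) p U).2 hp
      rwa [hβα] at this
    · have := (inc_iff (α⁻¹ * β) q U).2 hq
      rwa [hβα] at this
  change (onLines α)⁻¹ (onLines β U) = U at hU'
  rw [hβU, Equiv.Perm.inv_eq_iff_eq] at hU'
  exact hU'.symm

end PointLineGeometry

/-! ### The stages of the free completion -/

namespace PointLineGeometry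

variable {G : PointLineGeometry.{u}}

theorem IsPartialLinear.addPoints (h : G.IsPartialLinear) : G.addPoints.IsPartialLinear := by
  rintro (p | ⟨s, hs, hs'⟩) (q | ⟨t, ht, ht'⟩) l m h₁ h₂ h₃ h₄
  · exact (h h₁ h₂ h₃ h₄).imp_left (congrArg Sum.inl)
  · by_contra! hne
    have e : t = s(_, _) := (Sym2.mem_and_mem_iff hne.2).1 ⟨h₂, h₄⟩
    refine ht' ⟨p, fun k hk => ?_⟩
    rcases Sym2.mem_iff.1 (e.subst (motive := fun z => k ∈ z) hk) with rfl | rfl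
    exacts [h₁, h₃]
  · by_contra! hne
    have e : s = s(_, _) := (Sym2.mem_and_mem_iff hne.2).1 ⟨h₁, h₃⟩
    refine hs' ⟨q, fun k hk => ?_⟩
    rcases Sym2.mem_iff.1 (e.subst (motive := fun z => k ∈ z) hk) with rfl | rfl
    exacts [h₂, h₄]
  · by_cases hlm : l = m
    · exact Or.inr hlm
    · left
      have e := (Sym2.mem_and_mem_iff hlm).1 ⟨h₁, h₃⟩
      have e' := (Sym2.mem_and_mem_iff hlm).1 ⟨h₂, h₄⟩
      exact congrArg Sum.inr (Subtype.ext (e.trans e'.symm))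

theorem IsPartialLinear.addLines (h : G.IsPartialLinear) : G.addLines.IsPartialLinear := by
  rintro p q (l | ⟨s, hs, hs'⟩) (m | ⟨t, ht, ht'⟩) h₁ h₂ h₃ h₄
  · exact (h h₁ h₂ h₃ h₄).imp_right (congrArg Sum.inl)
  · by_contra! hne
    have e : t = s(_, _) := (Sym2.mem_and_mem_iff hne.1).1 ⟨h₃, h₄⟩
    refine ht' ⟨l, fun k hk => ?_⟩
    rcases Sym2.mem_iff.1 (e.subst (motive := fun z => k ∈ z) hk) with rfl | rfl
    exacts [h₁, h₂]
  · by_contra! hne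
    have e : s = s(_, _) := (Sym2.mem_and_mem_iff hne.1).1 ⟨h₁, h₂⟩
    refine hs' ⟨m, fun k hk => ?_⟩
    rcases Sym2.mem_iff.1 (e.subst (motive := fun z => k ∈ z) hk) with rfl | rfl
    exacts [h₃, h₄]
  · by_cases hpq : p = q
    · exact Or.inl hpq
    · right
      have e := (Sym2.mem_and_mem_iff hpq).1 ⟨h₁, h₂⟩
      have e' := (Sym2.mem_and_mem_iff hpq).1 ⟨h₃, h₄⟩
      exact congrArg Sum.inr (Subtype.ext (e.trans e'.symm))

theorem IsPartialLinear.stage (h : G.IsPartialLinear) : ∀ n, (G.stage n).IsPartialLinear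
  | 0 => h
  | n + 1 => (IsPartialLinear.stage h n).addPoints.addLines

variable (G)

/-- The map from the points of a stage to the points of the free completion. -/
def toFreePoint (n : ℕ) (p : (G.stage n).Point) : G.freeCompletion.Point := Quot.mk _ ⟨n, p⟩

/-- The map from the lines of a stage to the lines of the free completion. -/
def toFreeLine (n : ℕ) (l : (G.stage n).Line) : G.freeCompletion.Line := Quot.mk _ ⟨n, l⟩

theorem toFreePoint_succ (n : ℕ) (p : (G.stage n).Point) :
    G.toFreePoint (n + 1) (G.pointSucc n p) = G.toFreePoint n p :=
  (Quot.sound (.succ n p)).symm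

theorem toFreeLine_succ (n : ℕ) (l : (G.stage n).Line) :
    G.toFreeLine (n + 1) (G.lineSucc n l) = G.toFreeLine n l :=
  (Quot.sound (.succ n l)).symm

theorem exists_toFreePoint (P : G.freeCompletion.Point) : ∃ n p, G.toFreePoint n p = P := by
  obtain ⟨⟨n, p⟩, rfl⟩ := Quot.exists_rep P
  exact ⟨n, p, rfl⟩

theorem exists_toFreeLine (L : G.freeCompletion.Line) : ∃ n l, G.toFreeLine n l = L := by
  obtain ⟨⟨n, l⟩, rfl⟩ := Quot.exists_rep L
  exact ⟨n, l, rfl⟩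

/-- The first copy of a point of a stage, in the stage where the point is added. -/
def pointRoot : (n : ℕ) → (G.stage n).Point → Σ n, (G.stage n).Point
  | 0, p => ⟨0, p⟩
  | n + 1, p => Sum.elim (pointRoot n) (fun s => ⟨n + 1, Sum.inr s⟩) p

/-- The first copy of a line of a stage, in the stage where the line is added. -/
def lineRoot : (n : ℕ) → (G.stage n).Line → Σ n, (G.stage n).Line
  | 0, l => ⟨0, l⟩
  | n + 1, l => Sum.elim (lineRoot n) (fun s => ⟨n + 1, Sum.inr s⟩) l

theorem pointRoot_fst_le : ∀ (n : ℕ) (p : (G.stage n).Point), (G.pointRoot n p).1 ≤ n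
  | 0, _ => le_rfl
  | n + 1, .inl p => (pointRoot_fst_le n p).trans n.le_succ
  | _ + 1, .inr _ => le_rfl

theorem lineRoot_fst_le : ∀ (n : ℕ) (l : (G.stage n).Line), (G.lineRoot n l).1 ≤ n
  | 0, _ => le_rfl
  | n + 1, .inl l => (lineRoot_fst_le n l).trans n.le_succ
  | _ + 1, .inr _ => le_rfl

theorem pointRoot_injective : ∀ n, Function.Injective (G.pointRoot n)
  | 0, p, q, h => eq_of_heq (Sigma.mk.inj h).2
  | n + 1, .inl p, .inl q, h => congrArg Sum.inl (pointRoot_injective n h)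
  | n + 1, .inl p, .inr s, h => by
    have h1 : (G.pointRoot n p).1 = n + 1 := congrArg Sigma.fst h
    have := G.pointRoot_fst_le n p
    omega
  | n + 1, .inr s, .inl p, h => by
    have h1 : n + 1 = (G.pointRoot n p).1 := congrArg Sigma.fst h
    have := G.pointRoot_fst_le n p
    omega
  | n + 1, .inr s, .inr t, h => eq_of_heq (Sigma.mk.inj h).2

theorem lineRoot_injective : ∀ n, Function.Injective (G.lineRoot n)
  | 0, p, q, h => eq_of_heq (Sigma.mk.inj h).2
  | n + 1, .inl p, .inl q, h => congrArg Sum.inl (lineRoot_injective n h)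
  | n + 1, .inl p, .inr s, h => by
    have h1 : (G.lineRoot n p).1 = n + 1 := congrArg Sigma.fst h
    have := G.lineRoot_fst_le n p
    omega
  | n + 1, .inr s, .inl p, h => by
    have h1 : n + 1 = (G.lineRoot n p).1 := congrArg Sigma.fst h
    have := G.lineRoot_fst_le n p
    omega
  | n + 1, .inr s, .inr t, h => eq_of_heq (Sigma.mk.inj h).2

theorem toFreePoint_injective (n : ℕ) : Function.Injective (G.toFreePoint n) := fun p q h =>
  G.pointRoot_injective n <| congrArg (Quot.lift (r := G.PointRel) (fun a => G.pointRoot a.1 a.2)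
    (by rintro _ _ ⟨n, p⟩; rfl)) h

theorem toFreeLine_injective (n : ℕ) : Function.Injective (G.toFreeLine n) := fun p q h =>
  G.lineRoot_injective n <| congrArg (Quot.lift (r := G.LineRel) (fun a => G.lineRoot a.1 a.2)
    (by rintro _ _ ⟨n, p⟩; rfl)) h

/-- Each stage embeds into every later stage, compatibly with the maps to the free completion. -/
theorem exists_stage_map {n m : ℕ} (h : n ≤ m) :
    ∃ (f : (G.stage n).Point → (G.stage m).Point) (g : (G.stage n).Line → (G.stage m).Line),
      (∀ p, G.toFreePoint m (f p) = G.toFreePoint n p) ∧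
      (∀ l, G.toFreeLine m (g l) = G.toFreeLine n l) ∧
      ∀ p l, (G.stage m).Inc (f p) (g l) ↔ (G.stage n).Inc p l := by
  induction m, h using Nat.le_induction with
  | base => exact ⟨id, id, fun _ => rfl, fun _ => rfl, fun _ _ => Iff.rfl⟩
  | succ m _ ih =>
    obtain ⟨f, g, hf, hg, hfg⟩ := ih
    exact ⟨fun p => G.pointSucc m (f p), fun l => G.lineSucc m (g l),
      fun p => (G.toFreePoint_succ m _).trans (hf p),
      fun l => (G.toFreeLine_succ m _).trans (hg l), hfg⟩

theorem exists_toFreePoint_of_le {n m : ℕ} (h : n ≤ m) (p : (G.stage n).Point) :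
    ∃ q, G.toFreePoint m q = G.toFreePoint n p := by
  obtain ⟨f, _, hf, -⟩ := G.exists_stage_map h
  exact ⟨f p, hf p⟩

theorem exists_toFreeLine_of_le {n m : ℕ} (h : n ≤ m) (l : (G.stage n).Line) :
    ∃ k, G.toFreeLine m k = G.toFreeLine n l := by
  obtain ⟨_, g, -, hg, -⟩ := G.exists_stage_map h
  exact ⟨g l, hg l⟩

theorem inc_toFree_iff {n : ℕ} {p : (G.stage n).Point} {l : (G.stage n).Line} :
    G.freeCompletion.Inc (G.toFreePoint n p) (G.toFreeLine n l) ↔ (G.stage n).Inc p l := by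
  refine ⟨?_, fun h => ⟨n, p, l, rfl, rfl, h⟩⟩
  rintro ⟨m, q, k, hq, hk, h⟩
  obtain ⟨f, g, hf, hg, hfg⟩ := G.exists_stage_map (le_max_left n m)
  obtain ⟨f', g', hf', hg', hfg'⟩ := G.exists_stage_map (le_max_right n m)
  have e : f p = f' q :=
    G.toFreePoint_injective _ ((hf p).trans (hq.symm.trans (hf' q).symm))
  have e' : g l = g' k :=
    G.toFreeLine_injective _ ((hg l).trans (hk.symm.trans (hg' k).symm))
  rw [← hfg, e, e', hfg']
  exact h

/-- The pairs of lines of a stage to which a common point is added in the next stage. -/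
abbrev NewPoint (n : ℕ) : Type u :=
  {s : Sym2 (G.stage n).Line // ¬ s.IsDiag ∧ ¬ ∃ p, ∀ l ∈ s, (G.stage n).Inc p l}

/-- The pairs of points to which a common line is added in the second half of the passage from
a stage to the next. -/
abbrev NewLine (n : ℕ) : Type u :=
  {s : Sym2 (G.stage (n + 1)).Point //
    ¬ s.IsDiag ∧ ¬ ∃ l, ∀ p ∈ s, (G.stage (n + 1)).Inc p (G.lineSucc n l)}

/-- The point added for a pair of lines. -/
def newPoint (n : ℕ) (s : G.NewPoint n) : (G.stage (n + 1)).Point := Sum.inr s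

/-- The line added for a pair of points. -/
def newLine (n : ℕ) (s : G.NewLine n) : (G.stage (n + 1)).Line := Sum.inr s

theorem point_succ_cases {n : ℕ} (p : (G.stage (n + 1)).Point) :
    (∃ q, p = G.pointSucc n q) ∨ ∃ s, p = G.newPoint n s :=
  match p with
  | .inl q => .inl ⟨q, rfl⟩
  | .inr s => .inr ⟨s, rfl⟩

theorem line_succ_cases {n : ℕ} (l : (G.stage (n + 1)).Line) :
    (∃ m, l = G.lineSucc n m) ∨ ∃ s, l = G.newLine n s :=
  match l with
  | .inl m => .inl ⟨m, rfl⟩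
  | .inr s => .inr ⟨s, rfl⟩

theorem inc_newPoint_iff {n : ℕ} {s : G.NewPoint n} {l : (G.stage n).Line} :
    G.freeCompletion.Inc (G.toFreePoint (n + 1) (G.newPoint n s)) (G.toFreeLine n l) ↔
      l ∈ s.1 := by
  rw [← toFreeLine_succ, inc_toFree_iff]
  exact Iff.rfl

theorem inc_newLine_iff {n : ℕ} {s : G.NewLine n} {p : (G.stage (n + 1)).Point} :
    G.freeCompletion.Inc (G.toFreePoint (n + 1) p) (G.toFreeLine (n + 1) (G.newLine n s)) ↔
      p ∈ s.1 :=
  G.inc_toFree_iff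

/-- For two distinct lines of a stage, a common point exists in the next stage. -/
theorem exists_meet_toFreeLine {n : ℕ} {l m : (G.stage n).Line} (hlm : l ≠ m) :
    ∃ P, G.freeCompletion.Inc P (G.toFreeLine n l) ∧
      G.freeCompletion.Inc P (G.toFreeLine n m) := by
  by_cases h : ∃ p, ∀ k ∈ s(l, m), (G.stage n).Inc p k
  · obtain ⟨p, hp⟩ := h
    exact ⟨G.toFreePoint n p, G.inc_toFree_iff.2 (hp l (by simp)),
      G.inc_toFree_iff.2 (hp m (by simp))⟩
  · exact ⟨G.toFreePoint (n + 1) (G.newPoint n ⟨s(l, m), by simpa using hlm, h⟩),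
      G.inc_newPoint_iff.2 (by simp), G.inc_newPoint_iff.2 (by simp)⟩

/-- For two distinct points of a stage, a common line exists in the next stage. -/
theorem exists_join_toFreePoint {n : ℕ} {p q : (G.stage n).Point} (hpq : p ≠ q) :
    ∃ L, G.freeCompletion.Inc (G.toFreePoint n p) L ∧
      G.freeCompletion.Inc (G.toFreePoint n q) L := by
  rw [← G.toFreePoint_succ n p, ← G.toFreePoint_succ n q]
  by_cases h : ∃ l, ∀ r ∈ s(G.pointSucc n p, G.pointSucc n q),
      (G.stage (n + 1)).Inc r (G.lineSucc n l)
  · obtain ⟨l, hl⟩ := h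
    exact ⟨G.toFreeLine (n + 1) (G.lineSucc n l), G.inc_toFree_iff.2 (hl _ (by simp)),
      G.inc_toFree_iff.2 (hl _ (by simp))⟩
  · have hne : G.pointSucc n p ≠ G.pointSucc n q := fun e => hpq (Sum.inl_injective e)
    exact ⟨G.toFreeLine (n + 1) (G.newLine n ⟨s(_, _), by simpa using hne, h⟩),
      G.inc_newLine_iff.2 (by simp), G.inc_newLine_iff.2 (by simp)⟩

theorem exists_toFreePoint₂ (P Q : G.freeCompletion.Point) :
    ∃ n p q, G.toFreePoint n p = P ∧ G.toFreePoint n q = Q := by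
  obtain ⟨n, p, rfl⟩ := G.exists_toFreePoint P
  obtain ⟨m, q, rfl⟩ := G.exists_toFreePoint Q
  obtain ⟨p', hp⟩ := G.exists_toFreePoint_of_le (le_max_left n m) p
  obtain ⟨q', hq⟩ := G.exists_toFreePoint_of_le (le_max_right n m) q
  exact ⟨_, p', q', hp, hq⟩

theorem exists_toFreeLine₂ (L M : G.freeCompletion.Line) :
    ∃ n l m, G.toFreeLine n l = L ∧ G.toFreeLine n m = M := by
  obtain ⟨n, p, rfl⟩ := G.exists_toFreeLine L
  obtain ⟨m, q, rfl⟩ := G.exists_toFreeLine M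
  obtain ⟨p', hp⟩ := G.exists_toFreeLine_of_le (le_max_left n m) p
  obtain ⟨q', hq⟩ := G.exists_toFreeLine_of_le (le_max_right n m) q
  exact ⟨_, p', q', hp, hq⟩

variable {G}

theorem freeCompletion_exists_meet {L M : G.freeCompletion.Line} (h : L ≠ M) :
    ∃ P, G.freeCompletion.Inc P L ∧ G.freeCompletion.Inc P M := by
  obtain ⟨n, l, m, rfl, rfl⟩ := G.exists_toFreeLine₂ L M
  exact G.exists_meet_toFreeLine fun e => h (e ▸ rfl)

theorem freeCompletion_exists_join {P Q : G.freeCompletion.Point} (h : P ≠ Q) :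
    ∃ L, G.freeCompletion.Inc P L ∧ G.freeCompletion.Inc Q L := by
  obtain ⟨n, p, q, rfl, rfl⟩ := G.exists_toFreePoint₂ P Q
  exact G.exists_join_toFreePoint fun e => h (e ▸ rfl)

theorem IsPartialLinear.freeCompletion (h : G.IsPartialLinear) :
    G.freeCompletion.IsPartialLinear := by
  intro P Q L M h₁ h₂ h₃ h₄
  obtain ⟨n, p, q, rfl, rfl⟩ := G.exists_toFreePoint₂ P Q
  obtain ⟨m, l, k, rfl, rfl⟩ := G.exists_toFreeLine₂ L M
  obtain ⟨f, _, hf, -⟩ := G.exists_stage_map (le_max_left n m)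
  obtain ⟨_, g, -, hg, -⟩ := G.exists_stage_map (le_max_right n m)
  rw [← hf p, ← hf q, ← hg l, ← hg k] at *
  rw [inc_toFree_iff] at h₁ h₂ h₃ h₄
  exact (h.stage _ h₁ h₂ h₃ h₄).imp (congrArg _) (congrArg _)

/-! ### Projectivity of the free completion -/

/-- Four distinct points, any two of them on a common line but no three of them. -/
structure IsQuadrangle (G : PointLineGeometry.{u}) (f : Fin 4 → G.Point) : Prop where
  injective : Function.Injective f
  exists_join : ∀ i j, i ≠ j → ∃ l, G.Inc (f i) l ∧ G.Inc (f j) l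
  not_inc : ∀ i j k l, i ≠ j → i ≠ k → j ≠ k → G.Inc (f i) l → G.Inc (f j) l → ¬ G.Inc (f k) l

theorem IsQuadrangle.freeCompletion {f : Fin 4 → G.Point} (hf : G.IsQuadrangle f)
    (h : G.IsPartialLinear) : G.freeCompletion.IsQuadrangle fun i => freePoint (f i) where
  injective := (G.toFreePoint_injective 0).comp hf.injective
  exists_join i j hij := by
    obtain ⟨l, hi, hj⟩ := hf.exists_join i j hij
    exact ⟨freeLine l, G.inc_toFree_iff (n := 0).2 hi, G.inc_toFree_iff (n := 0).2 hj⟩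
  not_inc i j k L hij hik hjk hi hj hk := by
    obtain ⟨l, hil, hjl⟩ := hf.exists_join i j hij
    have e : L = G.toFreeLine 0 l := h.freeCompletion.line_eq
      (((G.toFreePoint_injective 0).comp hf.injective).ne hij) hi hj
      (G.inc_toFree_iff (n := 0).2 hil) (G.inc_toFree_iff (n := 0).2 hjl)
    subst e
    exact hf.not_inc i j k l hij hik hjk hil hjl (G.inc_toFree_iff (n := 0).1 hk)

theorem IsQuadrangle.isProjectivePlane {f : Fin 4 → G.Point} (hf : G.IsQuadrangle f)
    (h : G.IsPartialLinear) (hmeet : ∀ ⦃l m : G.Line⦄, l ≠ m → ∃ p, G.Inc p l ∧ G.Inc p m)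
    (hjoin : ∀ ⦃p q : G.Point⦄, p ≠ q → ∃ l, G.Inc p l ∧ G.Inc q l) : G.IsProjectivePlane := by
  obtain ⟨l₁, h₁₀, h₁₃⟩ := hf.exists_join 0 3 (by decide)
  obtain ⟨l₂, h₂₁, h₂₂⟩ := hf.exists_join 1 2 (by decide)
  obtain ⟨l₃, h₃₁, h₃₃⟩ := hf.exists_join 1 3 (by decide)
  have n₁₁ := hf.not_inc 0 3 1 l₁ (by decide) (by decide) (by decide) h₁₀ h₁₃
  have n₁₂ := hf.not_inc 0 3 2 l₁ (by decide) (by decide) (by decide) h₁₀ h₁₃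
  have n₂₀ := hf.not_inc 1 2 0 l₂ (by decide) (by decide) (by decide) h₂₁ h₂₂
  have n₃₀ := hf.not_inc 1 3 0 l₃ (by decide) (by decide) (by decide) h₃₁ h₃₃
  have n₃₂ := hf.not_inc 1 3 2 l₃ (by decide) (by decide) (by decide) h₃₁ h₃₃
  exact ⟨{
    exists_point := fun l => by
      by_contra! hl
      exact hf.not_inc 0 1 2 l (by decide) (by decide) (by decide) (hl _) (hl _) (hl _)
    exists_line := fun p => by
      by_contra! hp
      have e : p = f 1 := h.point_eq (l := l₂) (m := l₃) (fun e => n₃₂ (e ▸ h₂₂)) (hp _) (hp _)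
        h₂₁ h₃₁
      exact n₁₁ (e ▸ hp l₁)
    eq_or_eq := fun h₁ h₂ h₃ h₄ => h h₁ h₂ h₃ h₄
    mkPoint := fun hlm => (hmeet hlm).choose
    mkPoint_ax := fun hlm => (hmeet hlm).choose_spec
    mkLine := fun hpq => (hjoin hpq).choose
    mkLine_ax := fun hpq => (hjoin hpq).choose_spec
    exists_config := ⟨f 0, f 1, f 2, l₁, l₂, l₃, n₂₀, n₃₀, n₁₁, h₂₁, h₃₁, n₁₂, h₂₂, n₃₂⟩ }⟩

/-- Project the other three vertices of a quadrangle from a vertex off the line. -/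
theorem IsQuadrangle.exists_three_points {f : Fin 4 → G.Point} (hf : G.IsQuadrangle f)
    (h : G.IsProjectivePlane) (l : G.Line) :
    ∃ a b c, a ≠ b ∧ a ≠ c ∧ b ≠ c ∧ G.Inc a l ∧ G.Inc b l ∧ G.Inc c l := by
  obtain ⟨i, hi⟩ : ∃ i, ¬ G.Inc (f i) l := by
    by_contra! hl
    exact hf.not_inc 0 1 2 l (by decide) (by decide) (by decide) (hl _) (hl _) (hl _)
  have hex : ∀ j, ∃ s, j ≠ i → G.Inc s l ∧ ∃ k, G.Inc (f i) k ∧ G.Inc (f j) k ∧ G.Inc s k := by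
    intro j
    by_cases hj : j = i
    · exact ⟨f i, fun hj' => absurd hj hj'⟩
    · obtain ⟨k, hik, hjk⟩ := hf.exists_join i j (Ne.symm hj)
      obtain ⟨s, hsl, hsk⟩ := h.exists_meet (l := l) (m := k) (fun e => hi (e ▸ hik))
      exact ⟨s, fun _ => ⟨hsl, k, hik, hjk, hsk⟩⟩
  choose s hs using hex
  have hne : ∀ j k, j ≠ i → k ≠ i → j ≠ k → s j ≠ s k := by
    intro j k hj hk hjk e
    obtain ⟨hl, m, him, hjm, hsm⟩ := hs j hj
    obtain ⟨-, m', him', hkm', hsm'⟩ := hs k hk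
    have hm : m = m' := h.isPartialLinear.line_eq (p := f i) (q := s j)
      (fun e' => hi (e' ▸ hl)) him hsm him' (e ▸ hsm')
    subst hm
    exact hf.not_inc i j k m hj.symm hk.symm hjk him hjm hkm'
  obtain ⟨j, k, m, hj, hk, hm, hjk, hjm, hkm⟩ :
      ∃ j k m : Fin 4, j ≠ i ∧ k ≠ i ∧ m ≠ i ∧ j ≠ k ∧ j ≠ m ∧ k ≠ m := by
    clear hi hs hne
    revert i
    decide
  exact ⟨s j, s k, s m, hne _ _ hj hk hjk, hne _ _ hj hm hjm, hne _ _ hk hm hkm,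
    (hs j hj).1, (hs k hk).1, (hs m hm).1⟩

/-! ### Confined configurations and infinity -/

/-- A point of the free completion which is not a point of `G` is incident with at most two lines
of earlier stages. -/
theorem eq_or_eq_of_inc_new_point {n : ℕ} {P : G.freeCompletion.Point}
    (hP : P ∉ Set.range (G.toFreePoint n)) (hP' : P ∈ Set.range (G.toFreePoint (n + 1)))
    {L : Fin 3 → G.freeCompletion.Line} (hL : ∀ i, L i ∈ Set.range (G.toFreeLine n))
    (hinc : ∀ i, G.freeCompletion.Inc P (L i)) : L 0 = L 1 ∨ L 0 = L 2 ∨ L 1 = L 2 := by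
  obtain ⟨p, rfl⟩ := hP'
  obtain ⟨p, rfl⟩ | ⟨s, rfl⟩ := G.point_succ_cases p
  · exact absurd ⟨p, (G.toFreePoint_succ n p).symm⟩ hP
  choose l hl using hL
  have hs : ∀ i, l i ∈ s.1 := fun i => G.inc_newPoint_iff.1 (by rw [hl i]; exact hinc i)
  rw [← hl 0, ← hl 1, ← hl 2]
  obtain ⟨⟨a, b⟩, hab⟩ := s
  have hs' : ∀ i, l i = a ∨ l i = b := fun i => Sym2.mem_iff.1 (hs i)
  rcases hs' 0 with h0 | h0 <;> rcases hs' 1 with h1 | h1 <;> rcases hs' 2 with h2 | h2 <;>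
    simp [h0, h1, h2]

theorem eq_or_eq_of_inc_new_line {n : ℕ} {L : G.freeCompletion.Line}
    (hL : L ∉ Set.range (G.toFreeLine n)) (hL' : L ∈ Set.range (G.toFreeLine (n + 1)))
    {P : Fin 3 → G.freeCompletion.Point} (hP : ∀ i, P i ∈ Set.range (G.toFreePoint (n + 1)))
    (hinc : ∀ i, G.freeCompletion.Inc (P i) L) : P 0 = P 1 ∨ P 0 = P 2 ∨ P 1 = P 2 := by
  obtain ⟨l, rfl⟩ := hL'
  obtain ⟨l, rfl⟩ | ⟨s, rfl⟩ := G.line_succ_cases l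
  · exact absurd ⟨l, (G.toFreeLine_succ n l).symm⟩ hL
  choose p hp using hP
  have hs : ∀ i, p i ∈ s.1 := fun i => G.inc_newLine_iff.1 (by rw [hp i]; exact hinc i)
  rw [← hp 0, ← hp 1, ← hp 2]
  obtain ⟨⟨a, b⟩, hab⟩ := s
  have hs' : ∀ i, p i = a ∨ p i = b := fun i => Sym2.mem_iff.1 (hs i)
  rcases hs' 0 with h0 | h0 <;> rcases hs' 1 with h1 | h1 <;> rcases hs' 2 with h2 | h2 <;>
    simp [h0, h1, h2]

/-- If each line of `G` has at most two points, the free completion of `G` contains no finite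
confined configuration: among the elements of a finite configuration, consider those added in the
last step. -/
theorem hasNoConfined_freeCompletion
    (h2 : ∀ (l : G.Line) (a b c : G.Point), G.Inc a l → G.Inc b l → G.Inc c l →
      a = b ∨ a = c ∨ b = c) : G.freeCompletion.HasNoConfined := by
  classical
  intro S T hS hST hTS
  have hT : T.Nonempty := by
    obtain ⟨p, hp⟩ := hS
    obtain ⟨a, ha, -⟩ := hST p hp
    exact ⟨a, ha⟩
  have hPn : ∀ P, ∃ n, P ∈ Set.range (G.toFreePoint n) := G.exists_toFreePoint
  have hLn : ∀ L, ∃ n, L ∈ Set.range (G.toFreeLine n) := G.exists_toFreeLine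
  have hPmem : ∀ P n, Nat.find (hPn P) ≤ n → P ∈ Set.range (G.toFreePoint n) := by
    intro P n hn
    obtain ⟨p, hp⟩ := Nat.find_spec (hPn P)
    obtain ⟨q, hq⟩ := G.exists_toFreePoint_of_le hn p
    exact ⟨q, hq.trans hp⟩
  have hLmem : ∀ L n, Nat.find (hLn L) ≤ n → L ∈ Set.range (G.toFreeLine n) := by
    intro L n hn
    obtain ⟨l, hl⟩ := Nat.find_spec (hLn L)
    obtain ⟨k, hk⟩ := G.exists_toFreeLine_of_le hn l
    exact ⟨k, hk.trans hl⟩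
  obtain ⟨P, hP, hPmax⟩ := S.exists_max_image (fun P => Nat.find (hPn P)) hS
  obtain ⟨L, hL, hLmax⟩ := T.exists_max_image (fun L => Nat.find (hLn L)) hT
  by_cases hlt : Nat.find (hLn L) < Nat.find (hPn P)
  · obtain ⟨n, hn⟩ := Nat.exists_eq_succ_of_ne_zero (Nat.ne_of_gt (Nat.zero_lt_of_lt hlt))
    obtain ⟨a, ha, b, hb, c, hc, hab, hac, hbc, hPa, hPb, hPc⟩ := hST P hP
    have hle : ∀ M ∈ T, M ∈ Set.range (G.toFreeLine n) := fun M hM =>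
      hLmem M n ((hLmax M hM).trans (by omega))
    have := eq_or_eq_of_inc_new_point (n := n) (P := P)
      (Nat.find_min (hPn P) (by omega)) (hPmem P _ hn.le) (L := ![a, b, c])
      (Fin.forall_fin_succ.2 ⟨hle a ha, Fin.forall_fin_two.2 ⟨hle b hb, hle c hc⟩⟩)
      (Fin.forall_fin_succ.2 ⟨hPa, Fin.forall_fin_two.2 ⟨hPb, hPc⟩⟩)
    simp_all
  · obtain ⟨a, ha, b, hb, c, hc, hab, hac, hbc, hLa, hLb, hLc⟩ := hTS L hL
    have hle : ∀ M ∈ S, M ∈ Set.range (G.toFreePoint (Nat.find (hLn L))) := fun M hM =>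
      hPmem M _ ((hPmax M hM).trans (by omega))
    rcases Nat.eq_zero_or_eq_succ_pred (Nat.find (hLn L)) with hn | hn
    · obtain ⟨l, rfl⟩ := hLmem L 0 hn.le
      rw [hn] at hle
      obtain ⟨a, rfl⟩ := hle a ha
      obtain ⟨b, rfl⟩ := hle b hb
      obtain ⟨c, rfl⟩ := hle c hc
      rw [inc_toFree_iff] at hLa hLb hLc
      rcases h2 l a b c hLa hLb hLc with rfl | rfl | rfl
      exacts [hab rfl, hac rfl, hbc rfl]
    · generalize hm : (Nat.find (hLn L)).pred = n at hn
      rw [hn] at hle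
      have := eq_or_eq_of_inc_new_line (n := n) (L := L)
        (Nat.find_min (hLn L) (by omega)) (hLmem L _ hn.le) (P := ![a, b, c])
        (Fin.forall_fin_succ.2 ⟨hle a ha, Fin.forall_fin_two.2 ⟨hle b hb, hle c hc⟩⟩)
        (Fin.forall_fin_succ.2 ⟨hLa, Fin.forall_fin_two.2 ⟨hLb, hLc⟩⟩)
      simp_all

/-- A finite projective plane with at least three points on each line is a confined
configuration. -/
theorem IsProjectivePlane.infinite_points (h : G.IsProjectivePlane) (hconf : G.HasNoConfined)
    (h3 : ∀ l, ∃ a b c, a ≠ b ∧ a ≠ c ∧ b ≠ c ∧ G.Inc a l ∧ G.Inc b l ∧ G.Inc c l)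
    [Nonempty G.Point] : Infinite G.Point := by
  have hpl := h.isPartialLinear
  refine not_finite_iff_infinite.1 fun hfin => ?_
  have hfinL : Finite G.Line := by
    refine Finite.of_injective (fun l => {p | G.Inc p l}) fun l m e => ?_
    obtain ⟨a, b, _, hab, -, -, ha, hb, -⟩ := h3 l
    have hle : ∀ p, G.Inc p l → G.Inc p m := fun p hp => (Set.ext_iff.1 e p).1 hp
    exact hpl.line_eq hab ha hb (hle a ha) (hle b hb)
  have := Fintype.ofFinite G.Point
  have := Fintype.ofFinite G.Line
  refine hconf Finset.univ Finset.univ Finset.univ_nonempty (fun p _ => ?_) (fun l _ => ?_)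
  · obtain ⟨m, hm⟩ := h.exists_not_inc_point p
    obtain ⟨a, b, c, hab, hac, hbc, ha, hb, hc⟩ := h3 m
    have hne : ∀ q, G.Inc q m → p ≠ q := fun q hq e => hm (e ▸ hq)
    have hjoin : ∀ q q' l l', q ≠ q' → G.Inc q m → G.Inc q' m → G.Inc q l → G.Inc p l →
        G.Inc q' l' → G.Inc p l' → l ≠ l' := by
      rintro q q' l l' hqq' hq hq' hql hpl' hq'l hpl'' rfl
      exact hm (hpl.line_eq hqq' hql hq'l hq hq' ▸ hpl')
    obtain ⟨l₁, hp₁, h₁⟩ := h.exists_join (hne a ha)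
    obtain ⟨l₂, hp₂, h₂⟩ := h.exists_join (hne b hb)
    obtain ⟨l₃, hp₃, h₃⟩ := h.exists_join (hne c hc)
    exact ⟨l₁, Finset.mem_univ _, l₂, Finset.mem_univ _, l₃, Finset.mem_univ _,
      hjoin a b _ _ hab ha hb h₁ hp₁ h₂ hp₂, hjoin a c _ _ hac ha hc h₁ hp₁ h₃ hp₃,
      hjoin b c _ _ hbc hb hc h₂ hp₂ h₃ hp₃, hp₁, hp₂, hp₃⟩
  · obtain ⟨a, b, c, habc⟩ := h3 l
    exact ⟨a, Finset.mem_univ _, b, Finset.mem_univ _, c, Finset.mem_univ _, habc⟩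

theorem countable_stage (G : PointLineGeometry.{u}) [Countable G.Point] [Countable G.Line] :
    ∀ n, Countable (G.stage n).Point ∧ Countable (G.stage n).Line
  | 0 => ⟨‹_›, ‹_›⟩
  | n + 1 => by
    obtain ⟨_, _⟩ := countable_stage G n
    have h1 : Countable (Sym2 (G.stage n).Line) := inferInstanceAs (Countable (Quot _))
    have h2 : Countable (G.stage n).addPoints.Point :=
      inferInstanceAs (Countable ((G.stage n).Point ⊕ {s : Sym2 (G.stage n).Line // _}))
    have h3 : Countable (Sym2 (G.stage n).addPoints.Point) := inferInstanceAs (Countable (Quot _))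
    exact ⟨h2, inferInstanceAs
      (Countable ((G.stage n).Line ⊕ {s : Sym2 (G.stage n).addPoints.Point // _}))⟩

theorem countable_freeCompletion [Countable G.Point] [Countable G.Line] :
    Countable G.freeCompletion.Point ∧ Countable G.freeCompletion.Line := by
  have h1 := fun n => (countable_stage G n).1
  have h2 := fun n => (countable_stage G n).2
  exact ⟨inferInstanceAs (Countable (Quot _)), inferInstanceAs (Countable (Quot _))⟩

end PointLineGeometry

/-! ### Automorphisms of the free completion -/

/-- The action of a permutation on unordered pairs. -/
def sym2Perm {X : Type*} (e : Equiv.Perm X) : Equiv.Perm (Sym2 X) where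
  toFun := Sym2.map e
  invFun := Sym2.map e.symm
  left_inv s := by simp [Sym2.map_map]
  right_inv s := by simp [Sym2.map_map]

theorem mem_sym2Perm_iff {X : Type*} (e : Equiv.Perm X) (x : X) (s : Sym2 X) :
    e x ∈ sym2Perm e s ↔ x ∈ s := by
  change e x ∈ Sym2.map e s ↔ x ∈ s
  simp [Sym2.mem_map]

theorem sym2Perm_isDiag_iff {X : Type*} (e : Equiv.Perm X) (s : Sym2 X) :
    (sym2Perm e s).IsDiag ↔ s.IsDiag :=
  Sym2.isDiag_map e.injective

/-- A permutation whose cube is trivial cannot interchange two elements. -/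
theorem exists_fixed_of_sym2Perm_eq {X : Type*} {e : Equiv.Perm X} (he : ∀ x, e (e (e x)) = x)
    {s : Sym2 X} (hs : ¬ s.IsDiag) (hes : sym2Perm e s = s) : ∃ a b, a ≠ b ∧ e a = a ∧ e b = b := by
  induction s using Sym2.ind with
  | _ a b =>
    have hab : a ≠ b := by simpa using hs
    rcases Sym2.eq_iff.1 (show s(e a, e b) = s(a, b) from hes) with ⟨ha, hb⟩ | ⟨ha, hb⟩
    · exact ⟨a, b, hab, ha, hb⟩
    · have := he a
      rw [ha, hb, ha] at this
      exact absurd this.symm hab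

theorem sym2Perm_cube {X : Type*} {e : Equiv.Perm X} (he : ∀ x, e (e (e x)) = x) (s : Sym2 X) :
    sym2Perm e (sym2Perm e (sym2Perm e s)) = s := by
  change Sym2.map e (Sym2.map e (Sym2.map e s)) = s
  rw [Sym2.map_map, Sym2.map_map]
  have : (e ∘ e) ∘ e = id := funext he
  rw [this, Sym2.map_id]
  rfl

namespace PointLineGeometry

variable {G : PointLineGeometry.{u}}

/-- The automorphism of `G.addPoints` induced by an automorphism of `G`. -/
def addPointsAut (α : G.Aut) : G.addPoints.Aut :=
  ⟨(Equiv.sumCongr (onPoints α) ((sym2Perm (onLines α)).subtypePerm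
      (p := fun s => ¬ s.IsDiag ∧ ¬ ∃ p, ∀ l ∈ s, G.Inc p l) fun s => by
        rw [sym2Perm_isDiag_iff, (onPoints α).surjective.exists]
        refine and_congr_right fun _ => not_congr (exists_congr fun p => ?_)
        rw [(onLines α).surjective.forall]
        simp only [mem_sym2Perm_iff, inc_iff]),
    α.1.2),
    fun p l => by
      rcases p with p | s
      · exact inc_iff α p l
      · exact mem_sym2Perm_iff (onLines α) l s.1⟩

/-- The automorphism of `G.addLines` induced by an automorphism of `G`. -/
def addLinesAut (α : G.Aut) : G.addLines.Aut :=
  ⟨(α.1.1, Equiv.sumCongr (onLines α) ((sym2Perm (onPoints α)).subtypePerm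
      (p := fun s => ¬ s.IsDiag ∧ ¬ ∃ l, ∀ p ∈ s, G.Inc p l) fun s => by
        rw [sym2Perm_isDiag_iff, (onLines α).surjective.exists]
        refine and_congr_right fun _ => not_congr (exists_congr fun p => ?_)
        rw [(onPoints α).surjective.forall]
        simp only [mem_sym2Perm_iff, inc_iff])),
    fun p l => by
      rcases l with l | s
      · exact inc_iff α p l
      · exact mem_sym2Perm_iff (onPoints α) p s.1⟩

/-- The automorphism of a stage of the free construction induced by an automorphism of `G`. -/
def stageAut (α : G.Aut) : ∀ n, (G.stage n).Aut
  | 0 => α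
  | n + 1 => addLinesAut (addPointsAut (stageAut α n))

/-- The permutation of the points of the free completion induced by an automorphism of `G`. -/
def freePointsPerm (α : G.Aut) : Equiv.Perm G.freeCompletion.Point where
  toFun := Quot.map (fun a => ⟨a.1, onPoints (stageAut α a.1) a.2⟩) fun _ _ h =>
    match h with
    | .succ n p => .succ n (onPoints (stageAut α n) p)
  invFun := Quot.map (fun a => ⟨a.1, (onPoints (stageAut α a.1)).symm a.2⟩) fun _ _ h =>
    match h with
    | .succ n p => .succ n ((onPoints (stageAut α n)).symm p)
  left_inv := by
    rintro ⟨n, p⟩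
    exact congrArg (G.toFreePoint n) (Equiv.symm_apply_apply _ p)
  right_inv := by
    rintro ⟨n, p⟩
    exact congrArg (G.toFreePoint n) (Equiv.apply_symm_apply _ p)

/-- The permutation of the lines of the free completion induced by an automorphism of `G`. -/
def freeLinesPerm (α : G.Aut) : Equiv.Perm G.freeCompletion.Line where
  toFun := Quot.map (fun a => ⟨a.1, onLines (stageAut α a.1) a.2⟩) fun _ _ h =>
    match h with
    | .succ n l => .succ n (onLines (stageAut α n) l)
  invFun := Quot.map (fun a => ⟨a.1, (onLines (stageAut α a.1)).symm a.2⟩) fun _ _ h =>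
    match h with
    | .succ n l => .succ n ((onLines (stageAut α n)).symm l)
  left_inv := by
    rintro ⟨n, l⟩
    exact congrArg (G.toFreeLine n) (Equiv.symm_apply_apply _ l)
  right_inv := by
    rintro ⟨n, l⟩
    exact congrArg (G.toFreeLine n) (Equiv.apply_symm_apply _ l)

/-- The automorphism of the free completion induced by an automorphism of `G`. -/
def freeCompletionAut (α : G.Aut) : G.freeCompletion.Aut :=
  ⟨(freePointsPerm α, freeLinesPerm α), fun P L => by
    constructor
    · rintro ⟨n, p, l, hp, hl, h⟩
      have hP : G.toFreePoint n ((onPoints (stageAut α n)).symm p) = P :=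
        (freePointsPerm α).injective (((freePointsPerm α).apply_symm_apply (Quot.mk _ ⟨n, p⟩)).trans
          hp)
      have hL : G.toFreeLine n ((onLines (stageAut α n)).symm l) = L :=
        (freeLinesPerm α).injective (((freeLinesPerm α).apply_symm_apply (Quot.mk _ ⟨n, l⟩)).trans
          hl)
      refine ⟨n, _, _, hP, hL, (inc_iff (stageAut α n) _ _).1 ?_⟩
      rwa [Equiv.apply_symm_apply, Equiv.apply_symm_apply]
    · rintro ⟨n, p, l, rfl, rfl, h⟩
      exact ⟨n, _, _, rfl, rfl, (inc_iff (stageAut α n) p l).2 h⟩⟩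

theorem freeCompletionAut_toFreeLine (α : G.Aut) (n : ℕ) (l : (G.stage n).Line) :
    onLines (freeCompletionAut α) (G.toFreeLine n l) =
      G.toFreeLine n (onLines (stageAut α n) l) := rfl

theorem extends_freeCompletionAut (α : G.Aut) : Extends (freeCompletionAut α) α :=
  ⟨fun _ => rfl, fun _ => rfl⟩

/-- Two automorphisms of the free completion which agree on `G` are equal: every new point is
the common point of two earlier lines, and every new line joins two earlier points. -/
theorem Extends.unique (h : G.IsPartialLinear) {α : G.Aut} {β β' : G.freeCompletion.Aut}
    (hβ : Extends β α) (hβ' : Extends β' α) : β = β' := by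
  have hpl := h.freeCompletion
  have key : ∀ n, (∀ p, onPoints β (G.toFreePoint n p) = onPoints β' (G.toFreePoint n p)) ∧
      ∀ l, onLines β (G.toFreeLine n l) = onLines β' (G.toFreeLine n l) := by
    intro n
    induction n with
    | zero => exact ⟨fun p => (hβ.1 p).trans (hβ'.1 p).symm,
        fun l => (hβ.2 l).trans (hβ'.2 l).symm⟩
    | succ n ih =>
      have hpts : ∀ p, onPoints β (G.toFreePoint (n + 1) p) =
          onPoints β' (G.toFreePoint (n + 1) p) := by
        intro p
        obtain ⟨q, rfl⟩ | ⟨⟨⟨a, b⟩, hab, hab'⟩, rfl⟩ := G.point_succ_cases p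
        · rw [toFreePoint_succ, ih.1]
        · have hne : a ≠ b := by rintro rfl; exact hab rfl
          have ha := (G.inc_newPoint_iff (s := ⟨s(a, b), hab, hab'⟩)).2 (Sym2.mem_mk_left a b)
          have hb := (G.inc_newPoint_iff (s := ⟨s(a, b), hab, hab'⟩)).2 (Sym2.mem_mk_right a b)
          have ha' := (inc_iff β' _ _).2 ha
          have hb' := (inc_iff β' _ _).2 hb
          rw [← ih.2] at ha' hb'
          exact hpl.point_eq
            ((onLines β).injective.ne ((G.toFreeLine_injective n).ne hne))
            ((inc_iff β _ _).2 ha) ((inc_iff β _ _).2 hb) ha' hb'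
      refine ⟨hpts, fun l => ?_⟩
      obtain ⟨m, rfl⟩ | ⟨⟨⟨a, b⟩, hab, hab'⟩, rfl⟩ := G.line_succ_cases l
      · rw [toFreeLine_succ, ih.2]
      · have hne : a ≠ b := by rintro rfl; exact hab rfl
        have ha := (G.inc_newLine_iff (s := ⟨s(a, b), hab, hab'⟩)).2 (Sym2.mem_mk_left a b)
        have hb := (G.inc_newLine_iff (s := ⟨s(a, b), hab, hab'⟩)).2 (Sym2.mem_mk_right a b)
        have ha' := (inc_iff β' _ _).2 ha
        have hb' := (inc_iff β' _ _).2 hb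
        rw [← hpts] at ha' hb'
        exact hpl.line_eq
          ((onPoints β).injective.ne ((G.toFreePoint_injective (n + 1)).ne hne))
          ((inc_iff β _ _).2 ha) ((inc_iff β _ _).2 hb) ha' hb'
  refine Subtype.ext (Prod.ext (Equiv.ext fun P => ?_) (Equiv.ext fun L => ?_))
  · obtain ⟨n, p, rfl⟩ := G.exists_toFreePoint P
    exact (key n).1 p
  · obtain ⟨n, l, rfl⟩ := G.exists_toFreeLine L
    exact (key n).2 l

/-! ### Fixed elements -/

/-- The cube of `α` is trivial. -/
def CubeTrivial (α : G.Aut) : Prop :=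
  (∀ p, onPoints α (onPoints α (onPoints α p)) = p) ∧
    ∀ l, onLines α (onLines α (onLines α l)) = l

theorem cubeTrivial_of_orderOf {α : G.Aut} (h : orderOf α = 3) : CubeTrivial α := by
  have h1 : α * (α * α) = 1 := by
    have := pow_orderOf_eq_one α
    rwa [h, pow_succ', pow_two] at this
  exact ⟨fun p => congrArg (fun β : G.Aut => onPoints β p) h1,
    fun l => congrArg (fun β : G.Aut => onLines β l) h1⟩

theorem CubeTrivial.addPointsAut {α : G.Aut} (h : CubeTrivial α) :
    CubeTrivial (addPointsAut α) := by
  refine ⟨?_, h.2⟩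
  rintro (p | s)
  · exact congrArg Sum.inl (h.1 p)
  · exact congrArg Sum.inr (Subtype.ext (sym2Perm_cube h.2 s.1))

theorem CubeTrivial.addLinesAut {α : G.Aut} (h : CubeTrivial α) :
    CubeTrivial (addLinesAut α) := by
  refine ⟨h.1, ?_⟩
  rintro (l | s)
  · exact congrArg Sum.inl (h.2 l)
  · exact congrArg Sum.inr (Subtype.ext (sym2Perm_cube h.1 s.1))

/-- Let `α` have trivial cube, at most one fixed point and no fixed line. Then the same is true
for the automorphisms which `α` induces on the stages: a new fixed element would belong to a
fixed pair, whose two members would be fixed as well. -/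
theorem stageAut_fixed {α : G.Aut} (hα : CubeTrivial α)
    (hp : ∀ p q, onPoints α p = p → onPoints α q = q → p = q) (hl : ∀ l, onLines α l ≠ l) :
    ∀ n, CubeTrivial (stageAut α n) ∧
      (∀ p q, onPoints (stageAut α n) p = p → onPoints (stageAut α n) q = q → p = q) ∧
      ∀ l, onLines (stageAut α n) l ≠ l
  | 0 => ⟨hα, hp, hl⟩
  | n + 1 => by
    obtain ⟨h3, hpn, hln⟩ := stageAut_fixed hα hp hl n
    have hpts : ∀ p q, onPoints (addPointsAut (stageAut α n)) p = p →
        onPoints (addPointsAut (stageAut α n)) q = q → p = q := by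
      have hnew : ∀ s, onPoints (addPointsAut (stageAut α n)) (Sum.inr s) ≠ Sum.inr s := by
        intro s hs
        obtain ⟨a, -, -, ha, -⟩ := exists_fixed_of_sym2Perm_eq h3.2 s.2.1
          (congrArg Subtype.val (Sum.inr_injective hs))
        exact hln a ha
      rintro (p | s) (q | t) hp hq
      · exact congrArg Sum.inl (hpn p q (Sum.inl_injective hp) (Sum.inl_injective hq))
      · exact absurd hq (hnew t)
      · exact absurd hp (hnew s)
      · exact absurd hp (hnew s)
    refine ⟨h3.addPointsAut.addLinesAut, hpts, ?_⟩
    rintro (l | s) hs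
    · exact hln l (Sum.inl_injective hs)
    · obtain ⟨a, b, hab, ha, hb⟩ := exists_fixed_of_sym2Perm_eq h3.addPointsAut.1 s.2.1
        (congrArg Subtype.val (Sum.inr_injective hs))
      exact hab (hpts a b ha hb)

theorem freeCompletionAut_line_ne {α : G.Aut} (hα : CubeTrivial α)
    (hp : ∀ p q, onPoints α p = p → onPoints α q = q → p = q) (hl : ∀ l, onLines α l ≠ l)
    (L : G.freeCompletion.Line) : onLines (freeCompletionAut α) L ≠ L := by
  obtain ⟨n, l, rfl⟩ := G.exists_toFreeLine L
  rw [freeCompletionAut_toFreeLine]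
  exact (G.toFreeLine_injective n).ne ((stageAut_fixed hα hp hl n).2.2 l)

end PointLineGeometry

/-! ### Coordinates of the Fano plane -/

namespace PointLineGeometry

/-- Indices for the points and for the lines of a Fano plane with an anti-flag `(x, M)`. As a
point, `none` is `x`, the `(false, i)` are the points `aᵢ` on `M`, and `(true, i)` is the third
point `bᵢ` of the line through `x` and `aᵢ`. As a line, `none` is `M`, `(false, i)` is the line
through `x` and `aᵢ`, and `(true, i)` is the line through `aᵢ` and the two points `bⱼ` with
`j ≠ i`. -/
abbrev FanoIndex : Type := Option (Bool × ZMod 3)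

/-- Incidence in terms of the indices. -/
def fanoInc : FanoIndex → FanoIndex → Bool
  | none, none => false
  | none, some (b, _) => !b
  | some (b, _), none => !b
  | some (true, i), some (true, j) => i ≠ j
  | some (_, i), some (_, j) => i = j

theorem fanoInc_left_injective :
    ∀ u u', (∀ v, fanoInc u v = fanoInc u' v) → u = u' := by decide

theorem fanoInc_right_injective :
    ∀ v v', (∀ u, fanoInc u v = fanoInc u v') → v = v' := by decide

/-- The rotation of the indices about the anti-flag. -/
def fanoRotation : Equiv.Perm FanoIndex where
  toFun := Option.map fun z => (z.1, z.2 + 1)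
  invFun := Option.map fun z => (z.1, z.2 + 2)
  left_inv := by decide
  right_inv := by decide

theorem fanoInc_fanoRotation :
    ∀ u v, fanoInc (fanoRotation u) (fanoRotation v) = fanoInc u v := by decide

theorem fanoRotation_cube : ∀ u, fanoRotation (fanoRotation (fanoRotation u)) = u := by decide

theorem fanoRotation_eq_iff : ∀ u, fanoRotation u = u ↔ u = none := by decide

/-- The indices of the four points off `M`. -/
def fanoQuadrangle : Fin 4 → FanoIndex := ![none, some (true, 0), some (true, 1), some (true, 2)]

theorem fanoQuadrangle_injective : Function.Injective fanoQuadrangle := by decide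

theorem fanoInc_fanoQuadrangle_none : ∀ i, fanoInc (fanoQuadrangle i) none = false := by decide

theorem fanoQuadrangle_join : ∀ i j, i ≠ j → ∃ v, v ≠ none ∧
    fanoInc (fanoQuadrangle i) v = true ∧ fanoInc (fanoQuadrangle j) v = true := by decide

set_option maxRecDepth 4000 in
theorem fanoQuadrangle_not_inc : ∀ i j k v, i ≠ j → i ≠ k → j ≠ k →
    fanoInc (fanoQuadrangle i) v = true → fanoInc (fanoQuadrangle j) v = true →
    ¬ fanoInc (fanoQuadrangle k) v = true := by decide

variable {F : PointLineGeometry.{u}}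

theorem IsFanoPlane.ncard_eq (hF : F.IsFanoPlane) (l : F.Line) : {p | F.Inc p l}.ncard = 3 :=
  hF.2 l

theorem IsFanoPlane.eq_of_inc (hF : F.IsFanoPlane) {l : F.Line} {a b c p : F.Point} (hab : a ≠ b)
    (hac : a ≠ c) (hbc : b ≠ c) (ha : F.Inc a l) (hb : F.Inc b l) (hc : F.Inc c l)
    (hp : F.Inc p l) : p = a ∨ p = b ∨ p = c := by
  have hcard := hF.ncard_eq l
  have hfin : {p | F.Inc p l}.Finite := Set.finite_of_ncard_ne_zero (by omega)
  have hsub : ({a, b, c} : Set F.Point) ⊆ {p | F.Inc p l} := by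
    rintro q (rfl | rfl | rfl)
    exacts [ha, hb, hc]
  have h3 : ({a, b, c} : Set F.Point).ncard = 3 :=
    Set.ncard_eq_three.2 ⟨a, b, c, hab, hac, hbc, rfl⟩
  have heq := Set.eq_of_subset_of_ncard_le hsub (by omega) hfin
  have : p ∈ ({a, b, c} : Set F.Point) := heq ▸ hp
  simpa using this

theorem IsFanoPlane.exists_third_point (hF : F.IsFanoPlane) (l : F.Line) (a b : F.Point) :
    ∃ c, F.Inc c l ∧ c ≠ a ∧ c ≠ b := by
  by_contra! hcon
  have hsub : {p | F.Inc p l} ⊆ {a, b} := by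
    intro p hp
    by_cases hpa : p = a
    · exact Or.inl hpa
    · exact Or.inr (hcon p hp hpa)
  have h1 := Set.ncard_le_ncard hsub
  have h2 : ({a, b} : Set F.Point).ncard ≤ 2 :=
    (Set.ncard_insert_le a {b}).trans (by rw [Set.ncard_singleton])
  have h3 := hF.ncard_eq l
  omega

/-- Every Fano plane with an anti-flag has the same incidence table. -/
theorem IsFanoPlane.exists_coordinates (hF : F.IsFanoPlane) {x : F.Point} {M : F.Line}
    (hxM : ¬ F.Inc x M) : ∃ (eP : FanoIndex ≃ F.Point) (eL : FanoIndex ≃ F.Line),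
      eP none = x ∧ eL none = M ∧ ∀ u v, F.Inc (eP u) (eL v) ↔ fanoInc u v = true := by
  have h := hF.1
  have hpl := h.isPartialLinear
  obtain ⟨a, ha_inj, haM, ha_surj⟩ : ∃ a : ZMod 3 → F.Point, Function.Injective a ∧
      (∀ i, F.Inc (a i) M) ∧ ∀ p, F.Inc p M → ∃ i, a i = p := by
    have hcard : Nat.card {p | F.Inc p M} = 3 := hF.ncard_eq M
    have : Finite {p | F.Inc p M} := Nat.finite_of_card_ne_zero (by omega)
    let e : {p | F.Inc p M} ≃ ZMod 3 := Finite.equivFinOfCardEq hcard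
    exact ⟨fun i => (e.symm i).1, Subtype.val_injective.comp e.symm.injective,
      fun i => (e.symm i).2, fun p hp => ⟨e ⟨p, hp⟩, by simp⟩⟩
  have hxa : ∀ i, x ≠ a i := fun i e => hxM (e ▸ haM i)
  choose l hxl hal using fun i => h.exists_join (hxa i)
  choose b hbl hbx hba using fun i => hF.exists_third_point (l i) x (a i)
  have hlM : ∀ i, l i ≠ M := fun i e => hxM (e ▸ hxl i)
  have hal' : ∀ i j, F.Inc (a i) (l j) → i = j := fun i j hij =>
    ha_inj (hpl.point_eq (hlM j) hij (haM i) (hal j) (haM j))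
  have hl_inj : ∀ i j, l i = l j → i = j := fun i j e => hal' i j (e ▸ hal i)
  have hbM : ∀ i, ¬ F.Inc (b i) M := fun i hi =>
    hba i (hpl.point_eq (hlM i) (hbl i) hi (hal i) (haM i))
  have hbl' : ∀ i j, F.Inc (b i) (l j) → i = j := by
    intro i j hij
    by_contra hne
    exact hbx i (hpl.point_eq (fun e => hne (hl_inj i j e)) (hbl i) hij (hxl i) (hxl j))
  have hb_inj : ∀ i j, b i = b j → i = j := fun i j e => hbl' i j (e ▸ hbl j)
  have h12 : ∀ i : ZMod 3, i + 1 ≠ i + 2 := by decide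
  choose m hm₁ hm₂ using fun i : ZMod 3 =>
    h.exists_join (p := b (i + 1)) (q := b (i + 2)) fun e => h12 i (hb_inj _ _ e)
  have hmM : ∀ i, m i ≠ M := fun i e => hbM _ (e ▸ hm₁ i)
  have hml : ∀ i j, m i ≠ l j := fun i j e =>
    h12 i ((hbl' _ j (e ▸ hm₁ i)).trans (hbl' _ j (e ▸ hm₂ i)).symm)
  have ham : ∀ i, F.Inc (a i) (m i) := by
    intro i
    obtain ⟨p, hpm, hpM⟩ := h.exists_meet (hmM i)
    obtain ⟨t, rfl⟩ := ha_surj p hpM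
    have hne : ∀ j, F.Inc (b j) (m i) → t ≠ j := by
      rintro j hj rfl
      exact hml i t (hpl.line_eq (hba t) hj hpm (hbl t) (hal t))
    have key : ∀ i t : ZMod 3, t ≠ i + 1 → t ≠ i + 2 → t = i := by decide
    obtain rfl := key i t (hne _ (hm₁ i)) (hne _ (hm₂ i))
    exact hpm
  have ham' : ∀ i j, F.Inc (a i) (m j) → i = j := fun i j hij =>
    ha_inj (hpl.point_eq (hmM j) hij (haM i) (ham j) (haM j))
  have hbm : ∀ i j, i ≠ j → F.Inc (b i) (m j) := by
    intro i j hij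
    have key : ∀ i j : ZMod 3, i ≠ j → i = j + 1 ∨ i = j + 2 := by decide
    rcases key i j hij with rfl | rfl
    exacts [hm₁ j, hm₂ j]
  have hbm' : ∀ i, ¬ F.Inc (b i) (m i) := fun i hi =>
    hml i i (hpl.line_eq (hba i) hi (ham i) (hbl i) (hal i))
  have hxm : ∀ i, ¬ F.Inc x (m i) := fun i hi =>
    hml i (i + 1) (hpl.line_eq (hbx (i + 1)) (hm₁ i) hi (hbl _) (hxl _))
  let fP : FanoIndex → F.Point := fun u => match u with
    | none => x
    | some (false, i) => a i
    | some (true, i) => b i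
  let fL : FanoIndex → F.Line := fun v => match v with
    | none => M
    | some (false, i) => l i
    | some (true, i) => m i
  have hinc : ∀ u v, F.Inc (fP u) (fL v) ↔ fanoInc u v = true := by
    rintro (_ | ⟨_ | _, i⟩) (_ | ⟨_ | _, j⟩)
    · exact iff_of_false hxM (by simp [fanoInc])
    · exact iff_of_true (hxl j) (by simp [fanoInc])
    · exact iff_of_false (hxm j) (by simp [fanoInc])
    · exact iff_of_true (haM i) (by simp [fanoInc])
    · refine ⟨fun hi => by simpa [fanoInc] using hal' i j hi, fun hi => ?_⟩
      obtain rfl : i = j := by simpa [fanoInc] using hi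
      exact hal i
    · refine ⟨fun hi => by simpa [fanoInc] using ham' i j hi, fun hi => ?_⟩
      obtain rfl : i = j := by simpa [fanoInc] using hi
      exact ham i
    · exact iff_of_false (hbM i) (by simp [fanoInc])
    · refine ⟨fun hi => by simpa [fanoInc] using hbl' i j hi, fun hi => ?_⟩
      obtain rfl : i = j := by simpa [fanoInc] using hi
      exact hbl i
    · refine ⟨fun hi => ?_, fun hi => hbm i j (by simpa [fanoInc] using hi)⟩
      have hij : i ≠ j := by
        rintro rfl
        exact hbm' i hi
      simpa [fanoInc] using hij
  have hfP : Function.Bijective fP := by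
    refine ⟨fun u u' e => fanoInc_left_injective u u' fun v => ?_, fun p => ?_⟩
    · rw [Bool.eq_iff_iff, ← hinc, ← hinc, e]
    · by_cases hpx : p = x
      · exact ⟨none, hpx.symm⟩
      obtain ⟨k, hpk, hxk⟩ := h.exists_join hpx
      obtain ⟨q, hqk, hqM⟩ := h.exists_meet (l := k) (m := M) (fun e => hxM (e ▸ hxk))
      obtain ⟨i, rfl⟩ := ha_surj q hqM
      rw [hpl.line_eq (hxa i) hxk hqk (hxl i) (hal i)] at hpk
      rcases hF.eq_of_inc (hxa i) (hbx i).symm (hba i).symm (hxl i) (hal i) (hbl i) hpk with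
        e | e | e
      exacts [⟨none, e.symm⟩, ⟨some (false, i), e.symm⟩, ⟨some (true, i), e.symm⟩]
  have hfL : Function.Bijective fL := by
    refine ⟨fun v v' e => fanoInc_right_injective v v' fun u => ?_, fun k => ?_⟩
    · rw [Bool.eq_iff_iff, ← hinc, ← hinc, e]
    · by_cases hkM : k = M
      · exact ⟨none, hkM.symm⟩
      obtain ⟨q, hqk, hqM⟩ := h.exists_meet hkM
      obtain ⟨i, rfl⟩ := ha_surj q hqM
      by_cases hki : k = l i
      · exact ⟨some (false, i), hki.symm⟩
      have hi1 : ∀ i : ZMod 3, i ≠ i + 1 := by decide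
      have hkl : k ≠ l (i + 1) := fun e => hi1 i (hal' _ _ (e ▸ hqk))
      obtain ⟨s, hsk, hsl⟩ := h.exists_meet hkl
      refine ⟨some (true, i), ?_⟩
      rcases hF.eq_of_inc (hxa _) (hbx _).symm (hba _).symm (hxl _) (hal _) (hbl _) hsl with
        rfl | rfl | rfl
      · exact absurd (hpl.line_eq (hxa i) hsk hqk (hxl i) (hal i)) hki
      · exact absurd (hpl.line_eq (ha_inj.ne (hi1 i)) hqk hsk (haM _) (haM _)) hkM
      · exact (hpl.line_eq (fun e => hbM _ (e ▸ hqM)) hqk hsk (ham i) (hm₁ i)).symm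
  exact ⟨Equiv.ofBijective fP hfP, Equiv.ofBijective fL hfL, rfl, rfl, hinc⟩

theorem IsFanoPlane.exists_isOrderThreeFixingOnly (hF : F.IsFanoPlane) {x : F.Point} {M : F.Line}
    (hxM : ¬ F.Inc x M) : ∃ α : F.Aut, IsOrderThreeFixingOnly α x M := by
  obtain ⟨eP, eL, rfl, rfl, hinc⟩ := hF.exists_coordinates hxM
  let α : F.Aut := ⟨(eP.permCongr fanoRotation, eL.permCongr fanoRotation), fun p l => by
    obtain ⟨u, rfl⟩ := eP.surjective p
    obtain ⟨v, rfl⟩ := eL.surjective l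
    simp only [Equiv.permCongr_apply, Equiv.symm_apply_apply, hinc, fanoInc_fanoRotation]⟩
  have hP : ∀ u, onPoints α (eP u) = eP (fanoRotation u) := fun u => by
    change eP.permCongr fanoRotation (eP u) = _
    simp
  have hL : ∀ v, onLines α (eL v) = eL (fanoRotation v) := fun v => by
    change eL.permCongr fanoRotation (eL v) = _
    simp
  have hPfix : ∀ p, onPoints α p = p ↔ p = eP none := by
    intro p
    obtain ⟨u, rfl⟩ := eP.surjective p
    rw [hP, eP.apply_eq_iff_eq, eP.apply_eq_iff_eq, fanoRotation_eq_iff]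
  have hLfix : ∀ l, onLines α l = l ↔ l = eL none := by
    intro l
    obtain ⟨v, rfl⟩ := eL.surjective l
    rw [hL, eL.apply_eq_iff_eq, eL.apply_eq_iff_eq, fanoRotation_eq_iff]
  refine ⟨α, orderOf_eq_prime ?_ ?_, hPfix, hLfix⟩
  · rw [pow_succ, pow_two]
    refine Subtype.ext (Prod.ext (Equiv.ext fun p => ?_) (Equiv.ext fun l => ?_))
    · obtain ⟨u, rfl⟩ := eP.surjective p
      change onPoints α (onPoints α (onPoints α (eP u))) = eP u
      rw [hP, hP, hP, fanoRotation_cube]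
    · obtain ⟨v, rfl⟩ := eL.surjective l
      change onLines α (onLines α (onLines α (eL v))) = eL v
      rw [hL, hL, hL, fanoRotation_cube]
  · intro h1
    have h2 : eP (some (true, 0)) = eP none := (hPfix _).1 (by rw [h1]; rfl)
    exact absurd (eP.injective h2) (by decide)

/-! ### The affine plane of order two -/

theorem IsPartialLinear.deleteLine (h : F.IsPartialLinear) (M : F.Line) :
    (F.deleteLine M).IsPartialLinear := fun _ _ _ _ h₁ h₂ h₃ h₄ =>
  (h h₁ h₂ h₃ h₄).imp Subtype.ext Subtype.ext

theorem IsFanoPlane.exists_quadrangle (hF : F.IsFanoPlane) {x : F.Point} {M : F.Line}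
    (hxM : ¬ F.Inc x M) : ∃ f, (F.deleteLine M).IsQuadrangle f := by
  obtain ⟨eP, eL, rfl, rfl, hinc⟩ := hF.exists_coordinates hxM
  refine ⟨fun i => ⟨eP (fanoQuadrangle i), by
    rw [hinc, fanoInc_fanoQuadrangle_none]
    exact Bool.false_ne_true⟩, ?_, ?_, ?_⟩
  · exact fun i j e => fanoQuadrangle_injective (eP.injective (congrArg Subtype.val e))
  · intro i j hij
    obtain ⟨v, hv, hi, hj⟩ := fanoQuadrangle_join i j hij
    exact ⟨⟨eL v, eL.injective.ne hv⟩, (hinc _ _).2 hi, (hinc _ _).2 hj⟩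
  · rintro i j k ⟨l, hl⟩ hij hik hjk hi hj hk
    obtain ⟨v, rfl⟩ := eL.surjective l
    exact fanoQuadrangle_not_inc i j k v hij hik hjk ((hinc _ _).1 hi) ((hinc _ _).1 hj)
      ((hinc _ _).1 hk)

theorem IsFanoPlane.eq_or_eq_of_inc_deleteLine (hF : F.IsFanoPlane) (M : F.Line)
    (l : (F.deleteLine M).Line) (a b c : (F.deleteLine M).Point) (ha : (F.deleteLine M).Inc a l)
    (hb : (F.deleteLine M).Inc b l) (hc : (F.deleteLine M).Inc c l) :
    a = b ∨ a = c ∨ b = c := by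
  by_contra! hne
  obtain ⟨q, hql, hqM⟩ := hF.1.exists_meet l.2
  rcases hF.eq_of_inc (fun e => hne.1 (Subtype.ext e)) (fun e => hne.2.1 (Subtype.ext e))
    (fun e => hne.2.2 (Subtype.ext e)) ha hb hc hql with rfl | rfl | rfl
  exacts [a.2 hqM, b.2 hqM, c.2 hqM]

theorem IsFanoPlane.finite (hF : F.IsFanoPlane) {x : F.Point} {M : F.Line}
    (hxM : ¬ F.Inc x M) : Finite F.Point ∧ Finite F.Line := by
  obtain ⟨eP, eL, -⟩ := hF.exists_coordinates hxM
  exact ⟨Finite.of_equiv _ eP, Finite.of_equiv _ eL⟩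

/-! ### A Fano plane in every universe -/

/-- The Fano plane with the points and lines given by the indices. -/
def fanoPlane : PointLineGeometry.{u} where
  Point := ULift FanoIndex
  Line := ULift FanoIndex
  Inc p l := fanoInc p.down l.down = true

set_option maxRecDepth 20000 in
theorem fanoInc_eq_or_eq : ∀ u u' v v', fanoInc u v = true → fanoInc u' v = true →
    fanoInc u v' = true → fanoInc u' v' = true → u = u' ∨ v = v' := by decide

theorem exists_fanoInc_fanoInc : ∀ v v', ∃ u, fanoInc u v = true ∧ fanoInc u v' = true := by
  decide

theorem fanoInc_comm : ∀ u v, fanoInc u v = fanoInc v u := by decide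

theorem card_fanoInc : ∀ v, Fintype.card {u // fanoInc u v = true} = 3 := by decide

theorem isFanoPlane_fanoPlane : fanoPlane.{u}.IsFanoPlane := by
  have hq : fanoPlane.{u}.IsQuadrangle fun i => ⟨fanoQuadrangle i⟩ :=
    { injective := fun i j e => fanoQuadrangle_injective (congrArg ULift.down e)
      exists_join := fun i j hij => by
        obtain ⟨v, -, hi, hj⟩ := fanoQuadrangle_join i j hij
        exact ⟨⟨v⟩, hi, hj⟩
      not_inc := fun i j k l => fanoQuadrangle_not_inc i j k l.down }
  refine ⟨hq.isProjectivePlane ?_ ?_ ?_, fun l => ?_⟩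
  · exact fun p q l m h₁ h₂ h₃ h₄ => (fanoInc_eq_or_eq _ _ _ _ h₁ h₂ h₃ h₄).imp
      (ULift.down_injective ·) (ULift.down_injective ·)
  · intro l m _
    obtain ⟨u, hu, hu'⟩ := exists_fanoInc_fanoInc l.down m.down
    exact ⟨⟨u⟩, hu, hu'⟩
  · intro p q _
    obtain ⟨v, hv, hv'⟩ := exists_fanoInc_fanoInc p.down q.down
    exact ⟨⟨v⟩, (fanoInc_comm _ _).trans hv, (fanoInc_comm _ _).trans hv'⟩
  · have e : {p : fanoPlane.{u}.Point // p ∈ l} ≃ {u // fanoInc u l.down = true} :=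
      Equiv.ulift.subtypeEquiv fun _ => Iff.rfl
    exact (Nat.card_congr e).trans (Nat.card_eq_fintype_card.trans (card_fanoInc _))

end PointLineGeometry

/-! ### The Inheritance question -/

open PointLineGeometry in
/-- The extension of an automorphism `α` of order three from the affine plane `F_M` to its free
completion: it moves every line, so it acts nontrivially on the lines through `x`, and this action
is not inherited from any affine type line. -/
theorem freeCompletion_of_isFanoPlane (F : PointLineGeometry.{u}) (hF : F.IsFanoPlane)
    (x : F.Point) (M : F.Line) (hxM : ¬ F.Inc x M) (α : F.Aut)
    (hα : IsOrderThreeFixingOnly α x M) :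
    let C : PointLineGeometry.{u} := F.deleteLine M
    let α₀ : C.Aut := deleteLineAut α ((hα.2.2 M).mpr rfl)
    let xC : C.freeCompletion.Point := freePoint (G := C) ⟨x, hxM⟩
    C.freeCompletion.IsProjectivePlane ∧
    Countable C.freeCompletion.Point ∧ Infinite C.freeCompletion.Point ∧
    Countable C.freeCompletion.Line ∧ Infinite C.freeCompletion.Line ∧
    ∃ αbar : C.freeCompletion.Aut,
      Extends αbar α₀ ∧ (∀ β : C.freeCompletion.Aut, Extends β α₀ → β = αbar) ∧
      ∃ hx : αbar ∈ pointStabilizer xC,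
        lineAction xC ⟨αbar, hx⟩ ≠ 1 ∧
        (∀ (U : C.freeCompletion.Line) (hU : ¬ C.freeCompletion.Inc xC U),
          lineAction xC ⟨αbar, hx⟩ ∉ affineLineAut xC U hU) ∧
        ¬ Inheritance xC := by
  intro C α₀ xC
  have hpl : C.IsPartialLinear := hF.1.isPartialLinear.deleteLine M
  obtain ⟨f, hf⟩ := hF.exists_quadrangle hxM
  have hplane : C.freeCompletion.IsProjectivePlane :=
    (hf.freeCompletion hpl).isProjectivePlane hpl.freeCompletion
      (fun _ _ => freeCompletion_exists_meet) (fun _ _ => freeCompletion_exists_join)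
  have h3 := (hf.freeCompletion hpl).exists_three_points hplane
  have hconf : C.freeCompletion.HasNoConfined :=
    hasNoConfined_freeCompletion (hF.eq_or_eq_of_inc_deleteLine M)
  have : Nonempty C.freeCompletion.Point := ⟨xC⟩
  have hinf := hplane.infinite_points hconf h3
  have hpts := hplane.infinite_points_of_line h3
  have hinfL : Infinite C.freeCompletion.Line :=
    Set.infinite_univ_iff.1 ((hplane.infinite_lines_through hpts xC).mono (Set.subset_univ _))
  obtain ⟨_, _⟩ := hF.finite hxM
  have : Countable C.Point := inferInstanceAs (Countable {p : F.Point // ¬ F.Inc p M})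
  have : Countable C.Line := inferInstanceAs (Countable {l : F.Line // l ≠ M})
  obtain ⟨hcP, hcL⟩ := countable_freeCompletion (G := C)
  have hcube := cubeTrivial_of_orderOf hα.1
  have hcube₀ : CubeTrivial α₀ :=
    ⟨fun p => Subtype.ext (hcube.1 p.1), fun l => Subtype.ext (hcube.2 l.1)⟩
  have hfixP : ∀ p q, onPoints α₀ p = p → onPoints α₀ q = q → p = q := fun p q hp hq =>
    Subtype.ext (((hα.2.1 p.1).1 (congrArg Subtype.val hp)).trans
      ((hα.2.1 q.1).1 (congrArg Subtype.val hq)).symm)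
  have hfixL : ∀ l, onLines α₀ l ≠ l := fun l hl => l.2 ((hα.2.2 l.1).1 (congrArg Subtype.val hl))
  have hfix := freeCompletionAut_line_ne hcube₀ hfixP hfixL
  have hx : freeCompletionAut α₀ ∈ pointStabilizer xC :=
    congrArg freePoint (Subtype.ext ((hα.2.1 x).2 rfl) : onPoints α₀ ⟨x, hxM⟩ = ⟨x, hxM⟩)
  have hnot := hplane.lineAction_notMem_affineLineAut hconf hpts hx hfix
  refine ⟨hplane, hcP, hinf, hcL, hinfL, freeCompletionAut α₀, extends_freeCompletionAut α₀,
    fun β hβ => hβ.unique hpl (extends_freeCompletionAut α₀), hx, ?_, hnot, ?_⟩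
  · intro h1
    obtain ⟨l, hl⟩ := hplane.exists_line_through xC
    exact hfix l (congrArg
      (fun σ : Equiv.Perm {l // C.freeCompletion.Inc xC l} => (σ ⟨l, hl⟩).1) h1)
  · intro hI
    unfold Inheritance at hI
    obtain ⟨U, hU, hmem⟩ := Set.mem_iUnion₂.1 (hI.subset (MonoidHom.mem_range.2 ⟨
      ⟨freeCompletionAut α₀, hx⟩, rfl⟩))
    exact hnot U hU hmem

open PointLineGeometry in
theorem mainTheorem1 :
    -- every anti-flag of a Fano plane has an automorphism as required
    (∀ (F : PointLineGeometry.{u}), F.IsFanoPlane →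
      ∀ (x : F.Point) (M : F.Line), ¬ F.Inc x M → ∃ α : F.Aut, IsOrderThreeFixingOnly α x M) ∧
    -- the free completion, the extended automorphism, and its action on the lines through `x`
    (∀ (F : PointLineGeometry.{u}), F.IsFanoPlane →
      ∀ (x : F.Point) (M : F.Line) (hxM : ¬ F.Inc x M)
        (α : F.Aut) (hα : IsOrderThreeFixingOnly α x M),
        let C : PointLineGeometry.{u} := F.deleteLine M
        let α₀ : C.Aut := deleteLineAut α ((hα.2.2 M).mpr rfl)
        let xC : C.freeCompletion.Point := freePoint (G := C) ⟨x, hxM⟩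
        C.freeCompletion.IsProjectivePlane ∧
        Countable C.freeCompletion.Point ∧ Infinite C.freeCompletion.Point ∧
        Countable C.freeCompletion.Line ∧ Infinite C.freeCompletion.Line ∧
        ∃ αbar : C.freeCompletion.Aut,
          Extends αbar α₀ ∧ (∀ β : C.freeCompletion.Aut, Extends β α₀ → β = αbar) ∧
          ∃ hx : αbar ∈ pointStabilizer xC,
            lineAction xC ⟨αbar, hx⟩ ≠ 1 ∧
            (∀ (U : C.freeCompletion.Line) (hU : ¬ C.freeCompletion.Inc xC U),
              lineAction xC ⟨αbar, hx⟩ ∉ affineLineAut xC U hU) ∧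
            ¬ Inheritance xC) ∧
    -- the Inheritance question has a negative answer in the infinite case
    (∃ (G : PointLineGeometry.{u}) (μ : G.Point), G.IsProjectivePlane ∧
      Countable G.Point ∧ Infinite G.Point ∧ ¬ Inheritance μ) := by
  refine ⟨fun F hF x M hxM => hF.exists_isOrderThreeFixingOnly hxM,
    freeCompletion_of_isFanoPlane, ?_⟩
  have hF := isFanoPlane_fanoPlane.{u}
  have hxM : ¬ fanoPlane.{u}.Inc ⟨none⟩ ⟨none⟩ := Bool.false_ne_true
  obtain ⟨α, hα⟩ := hF.exists_isOrderThreeFixingOnly hxM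
  obtain ⟨hplane, hc, hinf, -, -, -, -, -, -, -, -, hI⟩ :=
    freeCompletion_of_isFanoPlane _ hF _ _ hxM α hα
  exact ⟨_, _, hplane, hc, hinf, hI⟩
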